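/- **Setting.** Fix $0\le\varepsilon<\tfrac12$, let $m\ge 0$ and $M=2^m$. *Source.* An $\varepsilon$-SV source emits bits jointly with classical side information $e$ (finite range) such that, conditioned on all earlier bits and on $e$, each bit is $0$ with probability in $[\tfrac12-\varepsilon,\tfrac12+\varepsilon]$. It emits $x_1,y_1,\dots,x_M,y_M$ and then $m$ further bits that select a run $r\in\{1,\dots,M\}$. All these bits are public. *Device.* The device has three separated components: Alice, Bob, and Charlie's trusted qubits (one per run). It is shared with an adversary Eve (input $z$, output $w$, finite alphabets) and is fixed independently of the source. It is described by positive semidefinite operators $\sigma_{\mathbf a\mathbf b w|\mathbf x\mathbf y z}$ on $(\mathbb C^2)^{\otimes M}$, $\mathbf a,\mathbf b,\mathbf x,\mathbf y\in\{0,1\}^M$, with $\sum_{\mathbf a,\mathbf b,w}\mathrm{Tr}\,\sigma_{\mathbf a\mathbf b w|\mathbf x\mathbf y z}=1$, subject to: $\sum_w\sigma$ does not depend on $z$; for every $0\le k\le M$, $\sum_{a_{k+1},\dots,a_M}\sigma$ does not depend on $x_{k+1},\dots,x_M$; and likewise for Bob (time-ordered no-signaling). Its honest part is $\sum_w\sigma_{\mathbf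 a\mathbf b w|\mathbf x\mathbf y z}$. A *sequential quantum assemblage* is a family $$\mathrm{Tr}_{AB}(V^\dagger\rho V),\qquad V=\prod_{k=1}^{M}K^{(k)}_{a_k|x_k}\otimes L^{(k)}_{b_k|y_k}\otimes\mathbb 1,$$ where $\rho$ is a state on $\bigotimes_{i=1}^M (H_{A_i}\otimes H_{B_i}\otimes\mathbb C^2)$ with finite-dimensional $H_{A_i},H_{B_i}$, the operators $K^{(k)}_{a|x},L^{(k)}_{b|y}$ act on the first $k$ particles of Alice and of Bob, and $\sum_aK^{(k)}_{a|x}K^{(k)\dagger}_{a|x}=\mathbb 1$, $\sum_bL^{(k)}_{b|y}L^{(k)\dagger}_{b|y}=\mathbb 1$. *GHZ assemblage.* $\sigma^{GHZ}_{ab|xy}=\mathrm{Tr}_{AB}\big((P_{a|x}\otimes P_{b|y}\otimes\mathbb 1)\,|\psi\rangle\langle\psi|\big)$ for $|\psi\rangle=(|000\rangle+|111\rangle)/\sqrt2$, where $P_{\cdot|0}$ measures in the basis $|+\rangle,|-\rangle$ and $P_{\cdot|1}$ in the basis $|0\rangle,|1\rangle$. Let $\rho_{ab|xy}=\sigma^{GHZ}_{ab|xy}/\mathrm{Tr}\,\sigma^{GHZ}_{ab|xy}$,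 and $\rho_{ab|xy}=0$ if $\sigma^{GHZ}_{ab|xy}=0$. *Protocol II.* The settings $x_i,y_i$ are input in the $M$ successive runs, giving outcomes $a_i,b_i$. In each run Charlie measures $\{\rho_{a_ib_i|x_iy_i},\mathbb 1-\rho_{a_ib_i|x_iy_i}\}$ on his $i$-th qubit. The protocol aborts unless every run gives the first result. Otherwise $r$ is selected with the last $m$ source bits and $R=a_r$ is the output. Write $p_{acc}$ for the probability of not aborting, $P(s,w,\mathbf x,\mathbf y,r,e|z)$ for the joint distribution conditioned on not aborting ($s$ the value of $R$), and $\Delta=\big|P(s,w,\mathbf x,\mathbf y,r,e|z)-\tfrac12\sum_{s'}P(s',w,\mathbf x,\mathbf y,r,e|z)\big|$. Let $$d=\sum_{s}\sum_{\mathbf x,\mathbf y,e}\max_z\sum_{r,w}\Delta,\qquad d'=\sum_{s}\sum_{\mathbf x,\mathbf y,r,e}\max_z\sum_{w}\Delta .$$ Thus in $d$ Eve chooses $z$ knowing $\mathbf x,\mathbf y,e$, and $r$ is revealed to her afterwards; in $d'$ she chooses $z$ knowing $r$ as well. If $p_{acc}=0$, put $P=0$ (so $d=d'=0$). **Theorem.**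 For every $0\le\varepsilon<\tfrac12$ there are constants $C,\kappa>0$ depending only on $\varepsilon$ such that for every $m\ge0$ and $M=2^m$: 1. The $M$-fold product of the GHZ assemblage is a sequential quantum assemblage, and every sequential quantum assemblage is the honest part of a device as above (with trivial Eve). 2. (Ideal quantum behaviour.) For every device whose honest part is the $M$-fold GHZ assemblage, every no-signaling Eve and every $\varepsilon$-SV source, $p_{acc}=1$ and $d'=0$: the output bit is perfectly uniform and independent of everything Eve holds. 3. (Certification.) For every device as above (in particular, whenever the honest part is quantum) and every $\varepsilon$-SV source, $p_{acc}\,d\le C M^{-\kappa}$. 4. For the same devices and sources, $p_{acc}\,d'\le(1-p_{acc})+C M^{-\kappa}\sqrt{1-p_{acc}}$. -/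

import Mathlib

open scoped Kronecker BigOperators ComplexOrder

noncomputable section

/-- Strings of `n` bits. -/
abbrev Bits (n : ℕ) : Type := Fin n → Fin 2

/-- Two strings agree on their first `k` entries. -/
def AgreeBelow {n : ℕ} (k : ℕ) (s t : Bits n) : Prop := ∀ i : Fin n, i.val < k → s i = t i

/-- Operators on Charlie's memory, the tensor product of `M` qubits, as matrices in the
computational basis. -/
abbrev QubitOp (M : ℕ) : Type := Matrix (Bits M) (Bits M) ℂ

/-- The product operator `T 0 ⊗ ⋯ ⊗ T (M - 1)`. -/
def tensorOp {M : ℕ} (T : Fin M → Matrix (Fin 2) (Fin 2) ℂ) : QubitOp M :=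
  Matrix.of fun u v => ∏ i, T i (u i) (v i)

/-! ### The GHZ assemblage and the steering test -/

/-- Amplitudes of the state `(|000⟩ + |111⟩) / √2`. -/
def ghzVec (p q u : Fin 2) : ℂ := if p = q ∧ q = u then ((Real.sqrt 2)⁻¹ : ℝ) else 0

/-- The projector of the outcome `a` for the setting `x`: the basis `|+⟩, |-⟩` for `x = 0`, the
basis `|0⟩, |1⟩` for `x = 1`. -/
def pauliProj (a x : Fin 2) : Matrix (Fin 2) (Fin 2) ℂ :=
  if x = 0 then
    (if a = 0 then !![1 / 2, 1 / 2; 1 / 2, 1 / 2] else !![1 / 2, -(1 / 2); -(1 / 2), 1 / 2])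
  else
    (if a = 0 then !![1, 0; 0, 0] else !![0, 0; 0, 1])

/-- Charlie's unnormalised qubit state `Tr_AB ((P_{a|x} ⊗ P_{b|y} ⊗ 1) |GHZ⟩⟨GHZ|)`. -/
def ghzRun (a b x y : Fin 2) : Matrix (Fin 2) (Fin 2) ℂ :=
  Matrix.of fun u v => ∑ p, ∑ p', ∑ q, ∑ q',
    pauliProj a x p p' * pauliProj b y q q' * ghzVec p' q' u * star (ghzVec p q v)

open Classical in
/-- The projector that Charlie tests in a run with settings `x, y` and outcomes `a, b`: the
normalised GHZ state of that position, and `0` where this position is empty. -/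
def testProj (a b x y : Fin 2) : Matrix (Fin 2) (Fin 2) ℂ :=
  if ghzRun a b x y = 0 then 0 else (ghzRun a b x y).trace⁻¹ • ghzRun a b x y

/-- A family `σ_{ab|xy}` of operators of Charlie, with the arguments in the order `a b x y`. -/
abbrev OpFamily (M : ℕ) : Type := Bits M → Bits M → Bits M → Bits M → QubitOp M

/-- The `M`-fold product of the GHZ assemblage. -/
def ghzFamily (M : ℕ) : OpFamily M :=
  fun a b x y => tensorOp fun i => ghzRun (a i) (b i) (x i) (y i)

/-! ### Sequential quantum devices -/

/-- The operator `T` on `⊗ᵢ ℂ^{d i}` acts on the factors `0, …, k` only: it is `T₀ ⊗ 1`. -/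
def ActsUpTo {M : ℕ} {d : Fin M → ℕ} (k : Fin M)
    (T : Matrix (∀ i, Fin (d i)) (∀ i, Fin (d i)) ℂ) : Prop :=
  ∃ T₀ : Matrix (∀ i : {i // i ≤ k}, Fin (d i)) (∀ i : {i // i ≤ k}, Fin (d i)) ℂ,
    ∀ u v, T u v =
      open Classical in
      if ∀ i, k < i → u i = v i then T₀ (fun i => u i) (fun i => v i) else 0

/-- A quantum model of `M` successive runs: a state of the particles of Alice, Bob and Charlie,
and in run `k` measurements of Alice and Bob, given by Kraus operators, on the particles that
arrived up to then. -/
structure SeqQuantumModel (M : ℕ) where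
  dA : Fin M → ℕ
  dB : Fin M → ℕ
  rho : Matrix ((∀ i, Fin (dA i)) × ((∀ i, Fin (dB i)) × Bits M))
    ((∀ i, Fin (dA i)) × ((∀ i, Fin (dB i)) × Bits M)) ℂ
  rho_pos : rho.PosSemidef
  rho_trace : rho.trace = 1
  /-- `K k a x` is Alice's operator in run `k` for the outcome `a` and the setting `x`. -/
  K : Fin M → Fin 2 → Fin 2 → Matrix (∀ i, Fin (dA i)) (∀ i, Fin (dA i)) ℂ
  /-- `L k b y` is Bob's operator in run `k` for the outcome `b` and the setting `y`. -/
  L : Fin M → Fin 2 → Fin 2 → Matrix (∀ i, Fin (dB i)) (∀ i, Fin (dB i)) ℂ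
  K_local : ∀ k a x, ActsUpTo k (K k a x)
  L_local : ∀ k b y, ActsUpTo k (L k b y)
  K_complete : ∀ k x, ∑ a, K k a x * (K k a x).conjTranspose = 1
  L_complete : ∀ k y, ∑ b, L k b y * (L k b y).conjTranspose = 1

/-- The product over the runs, in temporal order from left to right, of `K ⊗ L ⊗ 1`. -/
def SeqQuantumModel.kraus {M : ℕ} (Q : SeqQuantumModel M) (a b x y : Bits M) :
    Matrix ((∀ i, Fin (Q.dA i)) × ((∀ i, Fin (Q.dB i)) × Bits M))
      ((∀ i, Fin (Q.dA i)) × ((∀ i, Fin (Q.dB i)) × Bits M)) ℂ :=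
  (List.ofFn fun k : Fin M =>
    Q.K k (a k) (x k) ⊗ₖ (Q.L k (b k) (y k) ⊗ₖ (1 : QubitOp M))).prod

/-- The family `Tr_AB (V† ρ V)` of Charlie's unnormalised states, `V` the product of the Kraus
operators. -/
def SeqQuantumModel.family {M : ℕ} (Q : SeqQuantumModel M) : OpFamily M :=
  fun a b x y => Matrix.of fun u v => ∑ p, ∑ q,
    ((Q.kraus a b x y).conjTranspose * Q.rho * Q.kraus a b x y) (p, (q, u)) (p, (q, v))

/-- A sequential quantum assemblage. -/
def IsSeqQuantum {M : ℕ} (τ : OpFamily M) : Prop := ∃ Q : SeqQuantumModel M, Q.family = τ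

/-! ### No-signaling devices shared with the adversary -/

open Classical in
/-- A device of `M` runs shared by Alice, Bob, Charlie and Eve. `op a b w x y z` is the unnormalised
state of Charlie's `M` qubits when Alice, Bob and Eve input `x, y, z` and obtain `a, b, w`.
No component signals to another one, and for Alice and for Bob nothing is signaled
backward in time (`k = 0` is no-signaling from that party to everybody else). -/
structure Device (M : ℕ) (W Z : Type) [Fintype W] where
  op : Bits M → Bits M → W → Bits M → Bits M → Z → QubitOp M
  pos : ∀ a b w x y z, (op a b w x y z).PosSemidef
  norm : ∀ x y z, ∑ a, ∑ b, ∑ w, (op a b w x y z).trace = 1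
  alice : ∀ (k : ℕ) (a b : Bits M) (w : W) (x x' y : Bits M) (z : Z), AgreeBelow k x x' →
    ∑ a' with AgreeBelow k a' a, op a' b w x y z = ∑ a' with AgreeBelow k a' a, op a' b w x' y z
  bob : ∀ (k : ℕ) (a b : Bits M) (w : W) (x y y' : Bits M) (z : Z), AgreeBelow k y y' →
    ∑ b' with AgreeBelow k b' b, op a b' w x y z = ∑ b' with AgreeBelow k b' b, op a b' w x y' z
  eve : ∀ (a b x y : Bits M) (z z' : Z), ∑ w, op a b w x y z = ∑ w, op a b w x y z'

/-- The part of the device held by Alice, Bob and Charlie is the family `τ`. -/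
def Device.HasHonestPart {M : ℕ} {W Z : Type} [Fintype W] (D : Device M W Z)
    (τ : OpFamily M) : Prop :=
  ∀ a b x y z, ∑ w, D.op a b w x y z = τ a b x y

/-- The probability that the outcomes are `a, b, w` and that Charlie's qubit passes the
test of `testProj` in every run, given the inputs `x, y, z`. -/
def Device.passProb {M : ℕ} {W Z : Type} [Fintype W] (D : Device M W Z)
    (a b : Bits M) (w : W) (x y : Bits M) (z : Z) : ℝ :=
  (Matrix.trace ((tensorOp fun i => testProj (a i) (b i) (x i) (y i)) * D.op a b w x y z)).re

/-! ### Santha–Vazirani sources -/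

open Classical in
/-- The total weight, for fixed `e`, of the strings that agree with `s` below `k`. -/
def prefixWeight {n : ℕ} {E : Type} (p : Bits n → E → ℝ) (k : ℕ) (s : Bits n) (e : E) : ℝ :=
  ∑ t with AgreeBelow k t s, p t e

/-- An `ε`-SV source of `n` bits with classical side information `e`: conditioned on the earlier
bits and on `e`, each bit is `0` with a probability in `[1/2 - ε, 1/2 + ε]`. -/
structure SVSource (ε : ℝ) (n : ℕ) (E : Type) [Fintype E] where
  prob : Bits n → E → ℝ
  nonneg : ∀ s e, 0 ≤ prob s e
  sum_one : ∑ s, ∑ e, prob s e = 1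
  sv : ∀ (k : Fin n) (s : Bits n) (e : E), s k = 0 →
    (1 / 2 - ε) * prefixWeight prob k s e ≤ prefixWeight prob (k + 1) s e ∧
      prefixWeight prob (k + 1) s e ≤ (1 / 2 + ε) * prefixWeight prob k s e

/-! ### The protocol with `2 ^ m` runs

The source emits `x₀, y₀, x₁, y₁, …` and then `m` bits that select a run. -/

/-- Alice's setting in each run. -/
def aliceSetting {M : ℕ} (u : Bits (2 * M)) : Bits M := fun i => u ⟨2 * i.val, by omega⟩

/-- Bob's setting in each run. -/
def bobSetting {M : ℕ} (u : Bits (2 * M)) : Bits M := fun i => u ⟨2 * i.val + 1, by omega⟩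

/-- The run selected by `m` bits (binary expansion). -/
def selectedRun {m : ℕ} (v : Bits m) : Fin (2 ^ m) := finFunctionFinEquiv v

section Protocol

variable {ε : ℝ} {m : ℕ} {W Z E : Type} [Fintype W] [Fintype E]

/-- The probability, given Eve's input `z`, that the source emits the setting bits `u` and
the selection bits `v` with side information `e`, Eve's outcome is `w`, all runs pass the test,
and Alice's outcome in the selected run is `s`. -/
def jointProb (D : Device (2 ^ m) W Z) (S : SVSource ε (2 * 2 ^ m + m) E)
    (s : Fin 2) (u : Bits (2 * 2 ^ m)) (v : Bits m) (e : E) (w : W) (z : Z) : ℝ :=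
  S.prob (Fin.append u v) e *
    ∑ a, ∑ b, if a (selectedRun v) = s then
      D.passProb a b w (aliceSetting u) (bobSetting u) z else 0

/-- The probability that the protocol does not abort. -/
def accProb (D : Device (2 ^ m) W Z) (S : SVSource ε (2 * 2 ^ m + m) E) (z : Z) : ℝ :=
  ∑ s, ∑ u, ∑ v, ∑ e, ∑ w, jointProb D S s u v e w z

/-- The joint distribution conditioned on acceptance. -/
def condProb (D : Device (2 ^ m) W Z) (S : SVSource ε (2 * 2 ^ m + m) E)
    (s : Fin 2) (u : Bits (2 * 2 ^ m)) (v : Bits m) (e : E) (w : W) (z : Z) : ℝ :=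
  jointProb D S s u v e w z / accProb D S z

/-- The deviation of the output bit from a uniform bit that is independent of the rest. -/
def deviation (D : Device (2 ^ m) W Z) (S : SVSource ε (2 * 2 ^ m + m) E)
    (s : Fin 2) (u : Bits (2 * 2 ^ m)) (v : Bits m) (e : E) (w : W) (z : Z) : ℝ :=
  |condProb D S s u v e w z - 1 / 2 * ∑ s', condProb D S s' u v e w z|

/-- The composable distance when Eve chooses her input knowing all settings and `e`;
the selection bits are drawn, and made public, afterwards. -/
def compDist (D : Device (2 ^ m) W Z) (S : SVSource ε (2 * 2 ^ m + m) E) : ℝ :=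
  ∑ s, ∑ u, ∑ e, ⨆ z, ∑ v, ∑ w, deviation D S s u v e w z

/-- The composable distance when Eve chooses her input knowing, in addition, the
selection bits. -/
def compDistLate (D : Device (2 ^ m) W Z) (S : SVSource ε (2 * 2 ^ m + m) E) : ℝ :=
  ∑ s, ∑ u, ∑ v, ∑ e, ⨆ z, ∑ w, deviation D S s u v e w z

end Protocol

end

/-! Let `χ_r = ±1` encode Alice's outcome in run `r`. Multiplying a distance by the acceptance
probability removes the normalisation. What remains is the correlation `Device.corr` of `χ_r` with
the acceptance of all runs, in absolute value, averaged over the source. Two effects can make it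
large: `a_r` may be predictable when run `r` starts, or later tests may be passed more often for one
value of `a_r`.

Predictability is limited by complementarity. With Bob's setting `0`, Charlie tests along the X axis
if `x = 0` and along the Z axis if `x = 1`. A state that passes the first test has almost no Z
component, and passing the second makes Alice's outcome a readout of Z. As Alice cannot signal, the
sum over her outcomes of Charlie's states is the same for both settings, so her outcome at `x = 1`
is nearly unbiased; exchanging X and Z treats `x = 0`. This is `run_bias_le`. Applied to each class
of earlier outcomes that passed the earlier tests, it bounds the drift (`Device.sum_drift_le`) by a
square root of the probability of first failing in run `r` with reset settings. That probability is
summed over `w`, so it does not depend on Eve's input. The source gives each reset setting pair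
conditional probability at least `(1/2 - ε)^2`, and first failures in different runs are disjoint
events, so the sum over all runs is at most a constant times `1 - p_acc` (`sum_resetFail_le`). Since
no run is selected with conditional probability above `(1/2 + ε)^m`, the mean drift in the selected
run is of order `√((1/2 + ε)^m (1 - p_acc))`.

Postselection on later tests is treated by a martingale argument. Let `q_k` be the weight of the
outcomes with the first `k` tests passed. The differences between `χ_r` and its conditional mean
under `q_r` are orthogonal increments, up to the loss of mass as `k` grows, and this loss only
lowers second moments. Hence one final event cannot correlate with many of them: the Bessel
inequality `sum_mul_abs_fluctuation_le` bounds the weighted sum of correlations by `2 √(∑ t_r^2)`.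
With `t_r` the source's selection weights, this is again of order `√((1/2 + ε)^m)`, which proves the
certification bound. The argument needs one input of Eve for all runs, so it serves `compDist` only.

If Eve knows `r` before choosing `z`, the tests from run `r` on are simply dropped
(`Device.sum_abs_corr_le`). This costs the rejection probability and leaves the drift. For the ideal
behaviour `p_acc = 1`, and this second bound vanishes. -/

noncomputable section

/-! ### Finite weighted sums -/

/-- The Cauchy–Schwarz inequality for sums of geometric means. -/
lemma sum_sqrt_mul_le {ι : Type*} (s : Finset ι) (f g : ι → ℝ) (hf : ∀ i ∈ s, 0 ≤ f i)
    (hg : ∀ i ∈ s, 0 ≤ g i) :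
    ∑ i ∈ s, √(f i * g i) ≤ √((∑ i ∈ s, f i) * ∑ i ∈ s, g i) := by
  apply Real.le_sqrt_of_sq_le
  have h := Finset.sum_mul_sq_le_sq_mul_sq s (fun i => √(f i)) (fun i => √(g i))
  have e1 : ∑ i ∈ s, √(f i * g i) = ∑ i ∈ s, √(f i) * √(g i) :=
    Finset.sum_congr rfl fun i hi => Real.sqrt_mul (hf i hi) _
  have e2 : ∑ i ∈ s, √(f i) ^ 2 = ∑ i ∈ s, f i :=
    Finset.sum_congr rfl fun i hi => Real.sq_sqrt (hf i hi)
  have e3 : ∑ i ∈ s, √(g i) ^ 2 = ∑ i ∈ s, g i :=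
    Finset.sum_congr rfl fun i hi => Real.sq_sqrt (hg i hi)
  rw [e1]
  simpa only [e2, e3] using h

/-! ### Conditional means and a Bessel inequality for killed martingales -/

section CondMean

variable {Ω : Type*} [Fintype Ω] [DecidableEq Ω]

/-- The mean of `χ` under the weight `q`, conditioned on the value of `π`. -/
def condMean (π : Ω → Ω) (q χ : Ω → ℝ) (ω : Ω) : ℝ :=
  (∑ ω' with π ω' = π ω, q ω' * χ ω') / ∑ ω' with π ω' = π ω, q ω'

lemma condMean_congr {π : Ω → Ω} {q χ : Ω → ℝ} {ω ω' : Ω} (h : π ω = π ω') :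
    condMean π q χ ω = condMean π q χ ω' := by
  simp only [condMean, h]

lemma abs_condMean_le {π : Ω → Ω} {q χ : Ω → ℝ} (hq : ∀ ω, 0 ≤ q ω) (hχ : ∀ ω, |χ ω| ≤ 1)
    (ω : Ω) : |condMean π q χ ω| ≤ 1 := by
  rw [condMean, abs_div]
  apply div_le_one_of_le₀ _ (abs_nonneg _)
  rw [abs_of_nonneg (Finset.sum_nonneg fun i _ => hq i)]
  refine (Finset.abs_sum_le_sum_abs _ _).trans (Finset.sum_le_sum fun i _ => ?_)
  rw [abs_mul, abs_of_nonneg (hq i)]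
  exact mul_le_of_le_one_right (hq i) (hχ i)

/-- A fibre of weight zero has only zero terms because `q ≥ 0`, so the convention for division by
zero does no harm. -/
lemma fiber_weight_mul_condMean {π : Ω → Ω} {q χ : Ω → ℝ} (hq : ∀ ω, 0 ≤ q ω) (ω : Ω) :
    (∑ ω' with π ω' = π ω, q ω') * condMean π q χ ω = ∑ ω' with π ω' = π ω, q ω' * χ ω' := by
  rw [condMean]
  by_cases h : ∑ ω' with π ω' = π ω, q ω' = 0
  · rw [h, zero_mul, eq_comm]
    rw [Finset.sum_eq_zero_iff_of_nonneg fun i _ => hq i] at h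
    exact Finset.sum_eq_zero fun i hi => by rw [h i hi, zero_mul]
  · exact mul_div_cancel₀ _ h

/-- A function of `π` is orthogonal to the fluctuation around the conditional mean. -/
lemma sum_mul_sub_condMean {π : Ω → Ω} {q χ g : Ω → ℝ} (hq : ∀ ω, 0 ≤ q ω)
    (hg : ∀ ω ω', π ω = π ω' → g ω = g ω') :
    ∑ ω, q ω * (g ω * (χ ω - condMean π q χ ω)) = 0 := by
  rw [← Finset.sum_fiberwise Finset.univ π]
  refine Finset.sum_eq_zero fun η _ => ?_
  rcases (Finset.univ.filter fun ω => π ω = η).eq_empty_or_nonempty with h | ⟨ω₀, h⟩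
  · rw [h, Finset.sum_empty]
  · obtain rfl : π ω₀ = η := by simpa using h
    have : ∀ ω ∈ Finset.univ.filter (fun ω => π ω = π ω₀),
        q ω * (g ω * (χ ω - condMean π q χ ω)) =
          g ω₀ * (q ω * χ ω) - g ω₀ * condMean π q χ ω₀ * q ω := by
      intro ω hω
      have hω : π ω = π ω₀ := by simpa using hω
      rw [hg ω ω₀ hω, condMean_congr hω]
      ring
    rw [Finset.sum_congr rfl this, Finset.sum_sub_distrib, ← Finset.mul_sum, ← Finset.mul_sum,
      ← fiber_weight_mul_condMean hq]
    ring

/-- The conditional mean is constant on a fibre, so weight times its absolute value is the absolute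
value of the fibre sum; values `η` that are not attained contribute zero. This turns the mean of the
predictable part into `Device.drift`. -/
lemma sum_mul_abs_condMean_le {π : Ω → Ω} {q χ : Ω → ℝ} (hq : ∀ ω, 0 ≤ q ω) :
    ∑ ω, q ω * |condMean π q χ ω| ≤ ∑ η, |∑ ω with π ω = η, q ω * χ ω| := by
  rw [← Finset.sum_fiberwise Finset.univ π]
  refine Finset.sum_le_sum fun η _ => ?_
  rcases (Finset.univ.filter fun ω => π ω = η).eq_empty_or_nonempty with h | ⟨ω₀, h⟩
  · rw [h, Finset.sum_empty]
    exact abs_nonneg _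
  · obtain rfl : π ω₀ = η := by simpa using h
    rw [← fiber_weight_mul_condMean (χ := χ) hq, abs_mul,
      abs_of_nonneg (Finset.sum_nonneg fun i _ => hq i), Finset.sum_mul]
    refine Finset.sum_le_sum fun ω hω => ?_
    have hω : π ω = π ω₀ := by simpa using hω
    rw [condMean_congr hω]

variable {π : ℕ → Ω → Ω} {q χ : ℕ → Ω → ℝ}

/-- The second moment of a weighted sum of martingale differences, under weights that decrease
in time. -/
lemma sum_mul_sq_fluctuation_le
    (hπ : ∀ k ω ω', π (k + 1) ω = π (k + 1) ω' → π k ω = π k ω')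
    (hq : ∀ k ω, 0 ≤ q k ω) (hq' : ∀ k ω, q (k + 1) ω ≤ q k ω)
    (hχ : ∀ k ω, |χ k ω| ≤ 1) (hχ' : ∀ k ω ω', π (k + 1) ω = π (k + 1) ω' → χ k ω = χ k ω')
    (t : ℕ → ℝ) (n : ℕ) :
    ∑ ω, q n ω * (∑ k ∈ Finset.range n, t k * (χ k ω - condMean (π k) (q k) (χ k) ω)) ^ 2
      ≤ 4 * (∑ k ∈ Finset.range n, t k ^ 2) * ∑ ω, q 0 ω := by
  set X : ℕ → Ω → ℝ := fun k ω => χ k ω - condMean (π k) (q k) (χ k) ω with hX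
  set Y : ℕ → Ω → ℝ := fun n ω => ∑ k ∈ Finset.range n, t k * X k ω with hY
  have mono : ∀ n, ∑ ω, q n ω ≤ ∑ ω, q 0 ω := by
    intro n
    induction n with
    | zero => exact le_rfl
    | succ n ih => exact (Finset.sum_le_sum fun ω _ => hq' n ω).trans ih
  have hXinv : ∀ k ω ω', π (k + 1) ω = π (k + 1) ω' → X k ω = X k ω' := fun k ω ω' h => by
    simp only [hX, hχ' k ω ω' h, condMean_congr (hπ k ω ω' h)]
  have hYinv : ∀ n ω ω', π n ω = π n ω' → Y n ω = Y n ω' := by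
    intro n
    induction n with
    | zero => intro ω ω' _; simp [hY]
    | succ n ih =>
      intro ω ω' h
      have := ih ω ω' (hπ n ω ω' h)
      simp only [hY, Finset.sum_range_succ] at this ⊢
      rw [this, hXinv n ω ω' h]
  have hX2 : ∀ k ω, X k ω ^ 2 ≤ 4 := fun k ω => by
    have h1 := abs_le.1 (hχ k ω)
    have h2 := abs_le.1 (abs_condMean_le (π := π k) (hq k) (hχ k) ω)
    have : |X k ω| ≤ 2 := abs_le.2 ⟨by simp only [hX]; linarith, by simp only [hX]; linarith⟩
    have := sq_le_sq' (abs_le.1 this).1 (abs_le.1 this).2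
    linarith
  change ∑ ω, q n ω * Y n ω ^ 2 ≤ _
  induction n with
  | zero => simp [hY]
  | succ n ih =>
    calc ∑ ω, q (n + 1) ω * Y (n + 1) ω ^ 2
        -- The weight is changed before the square is expanded: the cross term vanishes under `q n`,
        -- with respect to which the conditional mean of `χ n` is taken, and not under `q (n + 1)`.
        ≤ ∑ ω, q n ω * Y (n + 1) ω ^ 2 :=
          Finset.sum_le_sum fun ω _ => mul_le_mul_of_nonneg_right (hq' n ω) (sq_nonneg _)
      _ = ∑ ω, q n ω * Y n ω ^ 2 + 2 * t n * ∑ ω, q n ω * (Y n ω * X n ω)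
            + t n ^ 2 * ∑ ω, q n ω * X n ω ^ 2 := by
          rw [Finset.mul_sum, Finset.mul_sum, ← Finset.sum_add_distrib, ← Finset.sum_add_distrib]
          refine Finset.sum_congr rfl fun ω _ => ?_
          have : Y (n + 1) ω = Y n ω + t n * X n ω := by simp only [hY, Finset.sum_range_succ]
          rw [this]
          ring
      _ ≤ 4 * (∑ k ∈ Finset.range n, t k ^ 2) * ∑ ω, q 0 ω + 2 * t n * 0
            + t n ^ 2 * (4 * ∑ ω, q 0 ω) := by
          refine add_le_add (add_le_add ih ?_) (mul_le_mul_of_nonneg_left ?_ (sq_nonneg _))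
          · exact le_of_eq (congrArg _ (sum_mul_sub_condMean (hq n) (hYinv n)))
          · calc ∑ ω, q n ω * X n ω ^ 2 ≤ ∑ ω, q n ω * 4 :=
                  Finset.sum_le_sum fun ω _ => mul_le_mul_of_nonneg_left (hX2 n ω) (hq n ω)
              _ = 4 * ∑ ω, q n ω := by rw [← Finset.sum_mul, mul_comm]
              _ ≤ _ := mul_le_mul_of_nonneg_left (mono n) (by norm_num)
      _ = _ := by rw [Finset.sum_range_succ]; ring

/-- A Bessel inequality for martingale differences: their correlations with the final weight are
square summable. -/
lemma sum_mul_abs_fluctuation_le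
    (hπ : ∀ k ω ω', π (k + 1) ω = π (k + 1) ω' → π k ω = π k ω')
    (hq : ∀ k ω, 0 ≤ q k ω) (hq' : ∀ k ω, q (k + 1) ω ≤ q k ω)
    (hχ : ∀ k ω, |χ k ω| ≤ 1) (hχ' : ∀ k ω ω', π (k + 1) ω = π (k + 1) ω' → χ k ω = χ k ω')
    (t : ℕ → ℝ) (n : ℕ) :
    ∑ k ∈ Finset.range n, t k * |∑ ω, q n ω * (χ k ω - condMean (π k) (q k) (χ k) ω)|
      ≤ 2 * √(∑ k ∈ Finset.range n, t k ^ 2) * ∑ ω, q 0 ω := by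
  set X : ℕ → Ω → ℝ := fun k ω => χ k ω - condMean (π k) (q k) (χ k) ω with hX
  -- Signs absorb the absolute values, so that one random variable `Y` carries all correlations at
  -- once and a single Cauchy–Schwarz suffices.
  choose σ hσ hσ' using fun k => show ∃ σ : ℝ, σ ^ 2 = 1 ∧
      |∑ ω, q n ω * X k ω| = σ * ∑ ω, q n ω * X k ω by
    rcases abs_choice (∑ ω, q n ω * X k ω) with h | h
    · exact ⟨1, by norm_num, by rw [h, one_mul]⟩
    · exact ⟨-1, by norm_num, by rw [h, neg_one_mul]⟩
  have key := sum_mul_sq_fluctuation_le hπ hq hq' hχ hχ' (fun k => t k * σ k) n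
  have mono : ∀ n, ∑ ω, q n ω ≤ ∑ ω, q 0 ω := by
    intro n
    induction n with
    | zero => exact le_rfl
    | succ n ih => exact (Finset.sum_le_sum fun ω _ => hq' n ω).trans ih
  have h0 : 0 ≤ ∑ ω, q 0 ω := Finset.sum_nonneg fun ω _ => hq 0 ω
  set Y : Ω → ℝ := fun ω => ∑ k ∈ Finset.range n, t k * σ k * X k ω with hY
  have e : ∑ k ∈ Finset.range n, t k * |∑ ω, q n ω * X k ω| = ∑ ω, q n ω * Y ω := by
    simp only [hσ', hY, Finset.mul_sum]
    rw [Finset.sum_comm]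
    exact Finset.sum_congr rfl fun ω _ => Finset.sum_congr rfl fun k _ => by ring
  have e2 : ∑ k ∈ Finset.range n, (t k * σ k) ^ 2 = ∑ k ∈ Finset.range n, t k ^ 2 :=
    Finset.sum_congr rfl fun k _ => by rw [mul_pow, hσ, mul_one]
  rw [e2] at key
  have cs := Finset.sum_mul_sq_le_sq_mul_sq Finset.univ (fun ω => √(q n ω))
    (fun ω => √(q n ω) * Y ω)
  have e3 : ∑ ω, √(q n ω) * (√(q n ω) * Y ω) = ∑ ω, q n ω * Y ω :=
    Finset.sum_congr rfl fun ω _ => by rw [← mul_assoc, Real.mul_self_sqrt (hq n ω)]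
  have e4 : ∑ ω, (√(q n ω) * Y ω) ^ 2 = ∑ ω, q n ω * Y ω ^ 2 :=
    Finset.sum_congr rfl fun ω _ => by rw [mul_pow, Real.sq_sqrt (hq n ω)]
  have e5 : ∑ ω, √(q n ω) ^ 2 = ∑ ω, q n ω :=
    Finset.sum_congr rfl fun ω _ => Real.sq_sqrt (hq n ω)
  rw [e3, e4, e5] at cs
  change ∑ k ∈ Finset.range n, t k * |∑ ω, q n ω * X k ω| ≤ _
  rw [e]
  refine abs_le_of_sq_le_sq' ?_ (by positivity) |>.2
  have hT : 0 ≤ ∑ k ∈ Finset.range n, t k ^ 2 := Finset.sum_nonneg fun k _ => sq_nonneg _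
  calc (∑ ω, q n ω * Y ω) ^ 2 ≤ (∑ ω, q n ω) * ∑ ω, q n ω * Y ω ^ 2 := cs
    _ ≤ (∑ ω, q 0 ω) * (4 * (∑ k ∈ Finset.range n, t k ^ 2) * ∑ ω, q 0 ω) :=
        mul_le_mul (mono n) key
          (Finset.sum_nonneg fun ω _ => mul_nonneg (hq n ω) (sq_nonneg _)) h0
    _ = _ := by rw [mul_pow, mul_pow, Real.sq_sqrt hT]; ring

end CondMean

/-! ### Sums over strings with a given prefix -/

/-- The string `s` with the entries from `k` on replaced by `0`. -/
def truncBits {n : ℕ} (k : ℕ) (s : Bits n) : Bits n := fun i => if i.val < k then s i else 0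

lemma truncBits_eq_iff {n k : ℕ} {s t : Bits n} :
    truncBits k s = truncBits k t ↔ AgreeBelow k s t := by
  constructor
  · intro h i hi
    simpa [truncBits, hi] using congrFun h i
  · intro h
    funext i
    by_cases hi : i.val < k
    · simp [truncBits, hi, h i hi]
    · simp [truncBits, hi]

lemma agreeBelow_truncBits {n : ℕ} (k : ℕ) (s : Bits n) : AgreeBelow k (truncBits k s) s :=
  fun i hi => by simp [truncBits, hi]

lemma AgreeBelow.refl {n : ℕ} (k : ℕ) (s : Bits n) : AgreeBelow k s s := fun _ _ => rfl

lemma AgreeBelow.symm {n k : ℕ} {s t : Bits n} (h : AgreeBelow k s t) : AgreeBelow k t s :=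
  fun i hi => (h i hi).symm

lemma AgreeBelow.trans {n k : ℕ} {r s t : Bits n} (h : AgreeBelow k r s) (h' : AgreeBelow k s t) :
    AgreeBelow k r t := fun i hi => (h i hi).trans (h' i hi)

lemma AgreeBelow.mono {n k l : ℕ} {s t : Bits n} (h : AgreeBelow l s t) (hkl : k ≤ l) :
    AgreeBelow k s t := fun i hi => h i (hi.trans_le hkl)

lemma AgreeBelow.eq {n k : ℕ} {s t : Bits n} (h : AgreeBelow k s t) (hk : n ≤ k) : s = t :=
  funext fun i => h i (i.isLt.trans_le hk)

lemma agreeBelow_update {n : ℕ} (s : Bits n) (k : Fin n) (c : Fin 2) :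
    AgreeBelow k (Function.update s k c) s := fun i hi => by
  rw [Function.update_of_ne]
  rintro rfl
  exact lt_irrefl _ hi

lemma agreeBelow_succ_iff {n : ℕ} {k : Fin n} {s t : Bits n} :
    AgreeBelow (k + 1) s t ↔ AgreeBelow k s t ∧ s k = t k := by
  constructor
  · exact fun h => ⟨h.mono (Nat.le_succ _), h k (Nat.lt_succ_self _)⟩
  · rintro ⟨h, h'⟩ i hi
    rcases Nat.lt_succ_iff_lt_or_eq.1 hi with hi | hi
    · exact h i hi
    · rw [Fin.ext hi]; exact h'

/-- The strings that vanish from `k` on represent the prefixes of length `k`. -/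
def prefixReps (n k : ℕ) : Finset (Bits n) := Finset.univ.filter fun s => truncBits k s = s

open Classical in
-- A sum over all strings splits into classes of strings with a common prefix, the form in which
-- time-ordered no-signaling can be used.
lemma sum_prefixReps {n : ℕ} {V : Type*} [AddCommMonoid V] (k : ℕ) (f : Bits n → V) :
    ∑ η ∈ prefixReps n k, ∑ s with AgreeBelow k s η, f s = ∑ s, f s := by
  rw [← Finset.sum_fiberwise_of_maps_to (s := Finset.univ) (t := prefixReps n k)
    (g := truncBits k)]
  · refine Finset.sum_congr rfl fun η hη => Finset.sum_congr ?_ fun _ _ => rfl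
    have hη : truncBits k η = η := by simpa [prefixReps] using hη
    ext s
    simp only [Finset.mem_filter, Finset.mem_univ, true_and]
    rw [← truncBits_eq_iff, hη]
  · intro s _
    simp only [prefixReps, Finset.mem_filter, Finset.mem_univ, true_and]
    exact truncBits_eq_iff.2 (agreeBelow_truncBits k s)

/-! ### Product operators -/

open scoped MatrixOrder in
lemma exists_conjTranspose_mul_self {n : Type*} [Fintype n] [DecidableEq n] {A : Matrix n n ℂ}
    (hA : A.PosSemidef) : ∃ B : Matrix n n ℂ, A = B.conjTranspose * B :=
  CStarAlgebra.nonneg_iff_eq_star_mul_self.mp hA.nonneg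

section TensorOp

variable {M : ℕ}

lemma tensorOp_mul (S T : Fin M → Matrix (Fin 2) (Fin 2) ℂ) :
    tensorOp S * tensorOp T = tensorOp fun i => S i * T i := by
  ext u v
  simp only [tensorOp, Matrix.mul_apply, Matrix.of_apply, Fintype.prod_sum,
    ← Finset.prod_mul_distrib]

lemma conjTranspose_tensorOp (T : Fin M → Matrix (Fin 2) (Fin 2) ℂ) :
    (tensorOp T).conjTranspose = tensorOp fun i => (T i).conjTranspose := by
  ext u v
  simp [tensorOp, Matrix.conjTranspose_apply]

lemma tensorOp_one : tensorOp (fun _ : Fin M => (1 : Matrix (Fin 2) (Fin 2) ℂ)) = 1 := by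
  ext u v
  simp only [tensorOp, Matrix.of_apply, Matrix.one_apply]
  rw [Fintype.prod_ite_zero]
  simp [funext_iff]

lemma trace_tensorOp (T : Fin M → Matrix (Fin 2) (Fin 2) ℂ) :
    (tensorOp T).trace = ∏ i, (T i).trace := by
  simp only [Matrix.trace, tensorOp, Matrix.diag_apply, Matrix.of_apply, Fintype.prod_sum]

lemma tensorOp_posSemidef {T : Fin M → Matrix (Fin 2) (Fin 2) ℂ} (hT : ∀ i, (T i).PosSemidef) :
    (tensorOp T).PosSemidef := by
  choose B hB using fun i => exists_conjTranspose_mul_self (hT i)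
  have : tensorOp T = (tensorOp B).conjTranspose * tensorOp B := by
    rw [conjTranspose_tensorOp, tensorOp_mul]
    exact congrArg _ (funext hB)
  rw [this]
  exact Matrix.posSemidef_conjTranspose_mul_self _

lemma tensorOp_update_apply (g : Fin M → Matrix (Fin 2) (Fin 2) ℂ) (r : Fin M)
    (A : Matrix (Fin 2) (Fin 2) ℂ) (u v : Bits M) :
    tensorOp (Function.update g r A) u v =
      A (u r) (v r) * ∏ i ∈ Finset.univ.erase r, g i (u i) (v i) := by
  simp only [tensorOp, Matrix.of_apply]
  rw [← Finset.mul_prod_erase _ _ (Finset.mem_univ r), Function.update_self]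
  congr 1
  refine Finset.prod_congr rfl fun i hi => ?_
  rw [Function.update_of_ne (Finset.ne_of_mem_erase hi)]

/-- The operator `g 0 ⊗ ⋯ ⊗ A ⊗ ⋯ ⊗ g (M - 1)` as a linear function of its factor `A` in the
position `r`. -/
def tensorOpAt (g : Fin M → Matrix (Fin 2) (Fin 2) ℂ) (r : Fin M) :
    Matrix (Fin 2) (Fin 2) ℂ →ₗ[ℝ] QubitOp M where
  toFun A := tensorOp (Function.update g r A)
  map_add' A B := by
    ext u v
    simp only [tensorOp_update_apply, Matrix.add_apply, add_mul]
  map_smul' c A := by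
    ext u v
    simp only [tensorOp_update_apply, Matrix.smul_apply, RingHom.id_apply, smul_mul_assoc]

end TensorOp

/-! ### Positive functionals on a single qubit of Charlie -/

lemma re_trace_mul_nonneg {n : Type*} [Fintype n] [DecidableEq n] {A B : Matrix n n ℂ}
    (hA : A.PosSemidef) (hB : B.PosSemidef) : 0 ≤ (A * B).trace.re := by
  obtain ⟨C, rfl⟩ := exists_conjTranspose_mul_self hA
  rw [Matrix.mul_assoc, Matrix.trace_mul_comm]
  exact (Complex.le_def.1 (hB.mul_mul_conjTranspose_same C).trace_nonneg).1

/-- `A ↦ Re Tr ((g 0 ⊗ ⋯ ⊗ A ⊗ ⋯ ⊗ g (M - 1)) σ)` with `A` in the position `r`. -/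
def reducedFunctional {M : ℕ} (g : Fin M → Matrix (Fin 2) (Fin 2) ℂ) (r : Fin M) (σ : QubitOp M) :
    Matrix (Fin 2) (Fin 2) ℂ →ₗ[ℝ] ℝ :=
  Complex.reLm ∘ₗ (Matrix.traceLinearMap (Bits M) ℝ ℂ) ∘ₗ
    (LinearMap.mulRight ℝ σ) ∘ₗ tensorOpAt g r

lemma reducedFunctional_apply {M : ℕ} (g : Fin M → Matrix (Fin 2) (Fin 2) ℂ) (r : Fin M)
    (σ : QubitOp M) (A : Matrix (Fin 2) (Fin 2) ℂ) :
    reducedFunctional g r σ A = (tensorOp (Function.update g r A) * σ).trace.re := rfl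

lemma reducedFunctional_sum {M : ℕ} (g : Fin M → Matrix (Fin 2) (Fin 2) ℂ) (r : Fin M)
    {ι : Type*} (s : Finset ι) (σ : ι → QubitOp M) (A : Matrix (Fin 2) (Fin 2) ℂ) :
    reducedFunctional g r (∑ j ∈ s, σ j) A = ∑ j ∈ s, reducedFunctional g r (σ j) A := by
  simp only [reducedFunctional_apply, Matrix.mul_sum, Matrix.trace_sum, Complex.re_sum]

lemma reducedFunctional_nonneg {M : ℕ} {g : Fin M → Matrix (Fin 2) (Fin 2) ℂ} {r : Fin M}
    {σ : QubitOp M} {A : Matrix (Fin 2) (Fin 2) ℂ} (hg : ∀ i, (g i).PosSemidef)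
    (hσ : σ.PosSemidef) (hA : A.PosSemidef) : 0 ≤ reducedFunctional g r σ A := by
  refine re_trace_mul_nonneg (tensorOp_posSemidef fun i => ?_) hσ
  by_cases hi : i = r
  · subst hi; rwa [Function.update_self]
  · rw [Function.update_of_ne hi]; exact hg i

/-! ### The steering test -/

/-- The amplitudes vanish unless all three bits agree, so a single term survives, with weight `1/2`.
-/
lemma ghzRun_apply (a b x y u v : Fin 2) :
    ghzRun a b x y u v = pauliProj a x v u * pauliProj b y v u / 2 := by
  have h : ((√2 : ℝ) : ℂ)⁻¹ * ((√2 : ℝ) : ℂ)⁻¹ = 1 / 2 := by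
    rw [← mul_inv, ← Complex.ofReal_mul, Real.mul_self_sqrt (by norm_num)]
    norm_num
  have h' : ∀ c : ℂ, c * ((√2 : ℝ) : ℂ)⁻¹ * ((√2 : ℝ) : ℂ)⁻¹ = c / 2 := fun c => by
    rw [mul_assoc, h]; ring
  simp only [ghzRun, Matrix.of_apply]
  generalize pauliProj a x = A
  generalize pauliProj b y = B
  fin_cases u <;> fin_cases v <;> simp [ghzVec, Fin.sum_univ_two, h']

lemma ghzRun_eq (a b x y : Fin 2) : ghzRun a b x y =
    if x = 0 ∧ y = 0 then (if a = b then !![1 / 8, 1 / 8; 1 / 8, 1 / 8]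
        else !![1 / 8, -(1 / 8); -(1 / 8), 1 / 8])
    else if x = 0 then (if b = 0 then !![1 / 4, 0; 0, 0] else !![0, 0; 0, 1 / 4])
    else if y = 0 then (if a = 0 then !![1 / 4, 0; 0, 0] else !![0, 0; 0, 1 / 4])
    else if a ≠ b then 0
    else if a = 0 then !![1 / 2, 0; 0, 0] else !![0, 0; 0, 1 / 2] := by
  ext u v
  rw [ghzRun_apply]
  fin_cases a <;> fin_cases b <;> fin_cases x <;> fin_cases y <;> fin_cases u <;> fin_cases v <;>
    norm_num [pauliProj]

/-- The rows with `y = 0` are the ones that certify: X eigenprojectors for `x = 0` and Z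
eigenprojectors for `x = 1`. -/
lemma testProj_eq (a b x y : Fin 2) : testProj a b x y =
    if x = 0 ∧ y = 0 then (if a = b then !![1 / 2, 1 / 2; 1 / 2, 1 / 2]
        else !![1 / 2, -(1 / 2); -(1 / 2), 1 / 2])
    else if x = 0 then (if b = 0 then !![1, 0; 0, 0] else !![0, 0; 0, 1])
    else if y = 0 then (if a = 0 then !![1, 0; 0, 0] else !![0, 0; 0, 1])
    else if a ≠ b then 0
    else if a = 0 then !![1, 0; 0, 0] else !![0, 0; 0, 1] := by
  rw [testProj, ghzRun_eq]
  have key : ∀ (A B : Matrix (Fin 2) (Fin 2) ℂ), A ≠ 0 → A.trace⁻¹ • A = B →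
    (open Classical in if A = 0 then 0 else A.trace⁻¹ • A) = B := fun A B h h' => by
      rw [if_neg h, h']
  fin_cases a <;> fin_cases b <;> fin_cases x <;> fin_cases y <;>
    first
    | (simp; done)
    | (apply key
       · intro h
         have h0 := congrFun (congrFun h 0) 0
         have h1 := congrFun (congrFun h 1) 1
         simp at h0 h1
       · ext u v
         fin_cases u <;> fin_cases v <;> simp [Matrix.trace_fin_two] <;> norm_num)

lemma testProj_mul_self (a b x y : Fin 2) :
    testProj a b x y * testProj a b x y = testProj a b x y := by
  rw [testProj_eq]
  ext u v
  fin_cases a <;> fin_cases b <;> fin_cases x <;> fin_cases y <;> fin_cases u <;> fin_cases v <;>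
    norm_num [Matrix.mul_apply, Fin.sum_univ_two]

lemma conjTranspose_testProj (a b x y : Fin 2) :
    (testProj a b x y).conjTranspose = testProj a b x y := by
  rw [testProj_eq]
  ext u v
  fin_cases a <;> fin_cases b <;> fin_cases x <;> fin_cases y <;> fin_cases u <;> fin_cases v <;>
    simp [Matrix.conjTranspose_apply]

lemma testProj_posSemidef (a b x y : Fin 2) : (testProj a b x y).PosSemidef := by
  rw [← testProj_mul_self]
  nth_rewrite 1 [← conjTranspose_testProj]
  exact Matrix.posSemidef_conjTranspose_mul_self _

lemma one_sub_testProj_posSemidef (a b x y : Fin 2) : (1 - testProj a b x y).PosSemidef := by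
  have h : (1 - testProj a b x y).conjTranspose * (1 - testProj a b x y) =
      1 - testProj a b x y := by
    rw [Matrix.conjTranspose_sub, Matrix.conjTranspose_one, conjTranspose_testProj,
      sub_mul, mul_sub, mul_sub, testProj_mul_self, one_mul, mul_one, one_mul, sub_self, sub_zero]
  rw [← h]
  exact Matrix.posSemidef_conjTranspose_mul_self _

lemma testProj_mul_ghzRun (a b x y : Fin 2) :
    testProj a b x y * ghzRun a b x y = ghzRun a b x y := by
  rw [testProj_eq, ghzRun_eq]
  ext u v
  fin_cases a <;> fin_cases b <;> fin_cases x <;> fin_cases y <;> fin_cases u <;> fin_cases v <;>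
    norm_num [Matrix.mul_apply, Fin.sum_univ_two]

lemma sum_trace_ghzRun (x y : Fin 2) : ∑ a, ∑ b, (ghzRun a b x y).trace = 1 := by
  simp only [ghzRun_eq, Fin.sum_univ_two]
  fin_cases x <;> fin_cases y <;> norm_num [Matrix.trace_fin_two]

/-- The Bloch vector of a positive functional lies in the ball. -/
lemma bloch_sq_le {φ : Matrix (Fin 2) (Fin 2) ℂ →ₗ[ℝ] ℝ}
    (hφ : ∀ A : Matrix (Fin 2) (Fin 2) ℂ, A.PosSemidef → 0 ≤ φ A) :
    φ !![1, 0; 0, -1] ^ 2 + φ !![0, 1; 1, 0] ^ 2 ≤ φ 1 ^ 2 := by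
  -- Positivity on the rank-one operators of the vectors `(α, 1)` makes a real quadratic in `α`
  -- nonnegative; its discriminant condition is the claim.
  have key : ∀ α : ℝ, 0 ≤ (φ 1 + φ !![1, 0; 0, -1]) * (α * α) + (2 * φ !![0, 1; 1, 0]) * α
      + (φ 1 - φ !![1, 0; 0, -1]) := by
    intro α
    have h := hφ _ (Matrix.posSemidef_vecMulVec_self_star ![(α : ℂ), 1])
    have e : Matrix.vecMulVec ![(α : ℂ), 1] (star ![(α : ℂ), 1]) =
        ((α * α + 1) / 2 : ℝ) • (1 : Matrix (Fin 2) (Fin 2) ℂ)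
          + ((α * α - 1) / 2 : ℝ) • (!![1, 0; 0, -1] : Matrix (Fin 2) (Fin 2) ℂ)
          + α • (!![0, 1; 1, 0] : Matrix (Fin 2) (Fin 2) ℂ) := by
      ext u v
      fin_cases u <;> fin_cases v <;> simp [Matrix.vecMulVec_apply] <;> ring
    rw [e, map_add, map_add, map_smul, map_smul, map_smul] at h
    simp only [smul_eq_mul] at h
    linarith
  have := discrim_le_zero key
  rw [discrim] at this
  nlinarith

/-- If a positive functional nearly passes a test along one axis of the Bloch ball, then its
component along an orthogonal axis is small. -/
lemma abs_le_two_mul_sqrt {t z x s : ℝ} (ht : 0 ≤ t) (h : z ^ 2 + x ^ 2 ≤ t ^ 2)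
    (hs : s = 1 ∨ s = -1) : |z| ≤ 2 * √(t * ((t - s * x) / 2)) := by
  have hx : |x| ≤ t := abs_le_of_sq_le_sq (by nlinarith [sq_nonneg z]) ht
  obtain ⟨h1, h2⟩ := abs_le.1 hx
  have hsx : s * x ≤ t := by rcases hs with rfl | rfl <;> linarith
  have hs2 : s * s = 1 := by rcases hs with rfl | rfl <;> norm_num
  refine abs_le_of_sq_le_sq ?_ (by positivity)
  have h0 : 0 ≤ t * ((t - s * x) / 2) := mul_nonneg ht (by linarith)
  rw [mul_pow, Real.sq_sqrt h0]
  -- The gap between `4 t (t - s x) / 2` and `t^2 - x^2` is exactly `(t - s x)^2`.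
  nlinarith [mul_nonneg (sub_nonneg.2 hsx) (sub_nonneg.2 hsx)]

/-- One run of a no-signaling device that nearly passes the tests for `y = 0` has a nearly
unbiased outcome of Alice. -/
lemma run_bias_le (φ : Fin 2 → Fin 2 → Fin 2 → Matrix (Fin 2) (Fin 2) ℂ →ₗ[ℝ] ℝ)
    (hφ : ∀ a b x (A : Matrix (Fin 2) (Fin 2) ℂ), A.PosSemidef → 0 ≤ φ a b x A)
    (hns : ∀ b A, ∑ a, φ a b 0 A = ∑ a, φ a b 1 A) (x : Fin 2) :
    |∑ b, φ 0 b x 1 - ∑ b, φ 1 b x 1| ≤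
      4 * √((∑ a, ∑ b, φ a b 0 1) * ∑ x, ∑ a, ∑ b, φ a b x (1 - testProj a b x 0)) := by
  have ht : ∀ a b x, 0 ≤ φ a b x 1 := fun a b x => hφ a b x 1 Matrix.PosSemidef.one
  have hf : ∀ a b x, 0 ≤ φ a b x (1 - testProj a b x 0) := fun a b x =>
    hφ a b x _ (one_sub_testProj_posSemidef a b x 0)
  have hft : ∀ a b x, φ a b x (1 - testProj a b x 0) ≤ φ a b x 1 := fun a b x => by
    rw [map_sub]
    exact sub_le_self _ (hφ a b x _ (testProj_posSemidef a b x 0))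
  have hp : ∑ a, ∑ b, φ a b 1 1 = ∑ a, ∑ b, φ a b 0 1 := by
    rw [Finset.sum_comm, Finset.sum_comm (f := fun a b => φ a b 0 1)]
    exact Finset.sum_congr rfl fun b _ => (hns b 1).symm
  set p := ∑ a, ∑ b, φ a b 0 1 with hp0
  set F : ℝ := ∑ x, ∑ a, ∑ b, φ a b x (1 - testProj a b x 0) with hF
  have hp' : ∀ x, ∑ a, ∑ b, φ a b x 1 = p := by
    intro x
    fin_cases x
    · rfl
    · exact hp
  have hp_nonneg : 0 ≤ p := Finset.sum_nonneg fun a _ => Finset.sum_nonneg fun b _ => ht a b 0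
  have hFx : ∀ x, ∑ a, ∑ b, φ a b x (1 - testProj a b x 0) ≤ F := fun x =>
    Finset.single_le_sum (f := fun x => ∑ a, ∑ b, φ a b x (1 - testProj a b x 0))
      (fun x _ => Finset.sum_nonneg fun a _ => Finset.sum_nonneg fun b _ => hf a b x)
      (Finset.mem_univ x)
  have hFx0 : ∀ x, 0 ≤ ∑ a, ∑ b, φ a b x (1 - testProj a b x 0) := fun x =>
    Finset.sum_nonneg fun a _ => Finset.sum_nonneg fun b _ => hf a b x
  have hF0 : 0 ≤ F := (hFx0 0).trans (hFx 0)
  -- The failure weight is at most `p` and at most `F`, hence at most their geometric mean. This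
  -- puts the linear error on the same footing as the square-root one.
  have hFp : ∀ x, ∑ a, ∑ b, φ a b x (1 - testProj a b x 0) ≤ √(p * F) := fun x => by
    refine Real.le_sqrt_of_sq_le ?_
    rw [sq]
    refine mul_le_mul ?_ (hFx x) (hFx0 x) hp_nonneg
    rw [← hp' x]
    exact Finset.sum_le_sum fun a _ => Finset.sum_le_sum fun b _ => hft a b x
  have hS : ∀ x, ∑ a, ∑ b, √(φ a b x 1 * φ a b x (1 - testProj a b x 0)) ≤ √(p * F) := fun x => by
    rw [← Fintype.sum_prod_type'
      (f := fun a b => √(φ a b x 1 * φ a b x (1 - testProj a b x 0)))]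
    refine (sum_sqrt_mul_le Finset.univ (fun c : Fin 2 × Fin 2 => φ c.1 c.2 x 1)
      (fun c => φ c.1 c.2 x (1 - testProj c.1 c.2 x 0)) (fun c _ => ht _ _ _)
      (fun c _ => hf _ _ _)).trans (Real.sqrt_le_sqrt ?_)
    rw [Fintype.sum_prod_type, Fintype.sum_prod_type, hp' x]
    exact mul_le_mul_of_nonneg_left (hFx x) hp_nonneg
  set sgn : Fin 2 → Fin 2 → ℝ := fun a b => if a = b then 1 else -1 with hsgn
  have hsgn' : ∀ a b, sgn a b = 1 ∨ sgn a b = -1 := fun a b => by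
    simp only [hsgn]; split_ifs <;> simp
  have ef0 : ∀ a b, φ a b 0 (1 - testProj a b 0 0) =
      (φ a b 0 1 - sgn a b * φ a b 0 !![0, 1; 1, 0]) / 2 := fun a b => by
    have : (1 - testProj a b 0 0) = (1 / 2 : ℝ) • (1 : Matrix (Fin 2) (Fin 2) ℂ)
        - (sgn a b / 2 : ℝ) • (!![0, 1; 1, 0] : Matrix (Fin 2) (Fin 2) ℂ) := by
      rw [testProj_eq]
      ext u v
      fin_cases a <;> fin_cases b <;> fin_cases u <;> fin_cases v <;> norm_num [hsgn]
    rw [this, map_sub, map_smul, map_smul, smul_eq_mul, smul_eq_mul]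
    ring
  have ef1 : ∀ a b, φ a b 1 (1 - testProj a b 1 0) =
      (φ a b 1 1 - sgn a 0 * φ a b 1 !![1, 0; 0, -1]) / 2 := fun a b => by
    have : (1 - testProj a b 1 0) = (1 / 2 : ℝ) • (1 : Matrix (Fin 2) (Fin 2) ℂ)
        - (sgn a 0 / 2 : ℝ) • (!![1, 0; 0, -1] : Matrix (Fin 2) (Fin 2) ℂ) := by
      rw [testProj_eq]
      ext u v
      fin_cases a <;> fin_cases b <;> fin_cases u <;> fin_cases v <;> norm_num [hsgn]
    rw [this, map_sub, map_smul, map_smul, smul_eq_mul, smul_eq_mul]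
    ring
  have hz : ∀ a b, |φ a b 0 !![1, 0; 0, -1]| ≤
      2 * √(φ a b 0 1 * φ a b 0 (1 - testProj a b 0 0)) := fun a b => by
    rw [ef0]
    exact abs_le_two_mul_sqrt (ht a b 0) (bloch_sq_le (hφ a b 0)) (hsgn' a b)
  have hx : ∀ a b, |φ a b 1 !![0, 1; 1, 0]| ≤
      2 * √(φ a b 1 1 * φ a b 1 (1 - testProj a b 1 0)) := fun a b => by
    rw [ef1]
    exact abs_le_two_mul_sqrt (ht a b 1) (by rw [add_comm]; exact bloch_sq_le (hφ a b 1))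
      (hsgn' a 0)
  have hS0 := hS 0
  have hS1 := hS 1
  have hFp0 := hFp 0
  have hFp1 := hFp 1
  have nz0 := hns 0 !![1, 0; 0, -1]
  have nz1 := hns 1 !![1, 0; 0, -1]
  have nx0 := hns 0 !![0, 1; 1, 0]
  have nx1 := hns 1 !![0, 1; 1, 0]
  simp only [Fin.sum_univ_two] at hS0 hS1 hFp0 hFp1 nz0 nz1 nx0 nx1 ⊢
  have a00 := hf 0 0
  have a01 := hf 0 1
  have a10 := hf 1 0
  have a11 := hf 1 1
  have s00 : sgn 0 0 = 1 := by simp [hsgn]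
  have s01 : sgn 0 1 = -1 := by simp [hsgn]
  have s10 : sgn 1 0 = -1 := by simp [hsgn]
  have s11 : sgn 1 1 = 1 := by simp [hsgn]
  have hx' : x = 0 ∨ x = 1 := by omega
  -- For `x = 0` and fixed `b`, the bias is, up to twice the failures, plus or minus the X component
  -- summed over `a`. No-signaling moves this sum to `x = 1`, where each term is small by `hx`. For
  -- `x = 1` the same is done with Z and `hz`. Each of the two errors is at most `2 √(p F)`.
  rcases hx' with rfl | rfl
  · have x00 := abs_le.1 (hx 0 0)
    have x01 := abs_le.1 (hx 0 1)
    have x10 := abs_le.1 (hx 1 0)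
    have x11 := abs_le.1 (hx 1 1)
    have e00 := ef0 0 0
    have e01 := ef0 0 1
    have e10 := ef0 1 0
    have e11 := ef0 1 1
    rw [s00] at e00
    rw [s01] at e01
    rw [s10] at e10
    rw [s11] at e11
    have a00 := a00 0
    have a01 := a01 0
    have a10 := a10 0
    have a11 := a11 0
    exact abs_le.2 ⟨by linarith, by linarith⟩
  · have x00 := abs_le.1 (hz 0 0)
    have x01 := abs_le.1 (hz 0 1)
    have x10 := abs_le.1 (hz 1 0)
    have x11 := abs_le.1 (hz 1 1)
    have e00 := ef1 0 0
    have e01 := ef1 0 1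
    have e10 := ef1 1 0
    have e11 := ef1 1 1
    rw [s00] at e00 e01
    rw [s10] at e10 e11
    have a00 := a00 1
    have a01 := a01 1
    have a10 := a10 1
    have a11 := a11 1
    exact abs_le.2 ⟨by linarith, by linarith⟩

/-! ### Passing the tests of the first runs -/

/-- The tests of the runs below `k`, and no test in the later runs. -/
def partialTest {M : ℕ} (k : ℕ) (a b x y : Bits M) : Fin M → Matrix (Fin 2) (Fin 2) ℂ :=
  fun i => if i.val < k then testProj (a i) (b i) (x i) (y i) else 1

lemma partialTest_congr {M k : ℕ} {a a' b b' x x' y y' : Bits M} (ha : AgreeBelow k a a')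
    (hb : AgreeBelow k b b') (hx : AgreeBelow k x x') (hy : AgreeBelow k y y') :
    partialTest k a b x y = partialTest k a' b' x' y' := by
  funext i
  by_cases hi : i.val < k
  · simp only [partialTest, hi, if_true, ha i hi, hb i hi, hx i hi, hy i hi]
  · simp only [partialTest, hi, if_false]

lemma partialTest_posSemidef {M : ℕ} (k : ℕ) (a b x y : Bits M) (i : Fin M) :
    (partialTest k a b x y i).PosSemidef := by
  rw [partialTest]
  split_ifs
  · exact testProj_posSemidef _ _ _ _
  · exact Matrix.PosSemidef.one

lemma update_partialTest_one {M : ℕ} (r : Fin M) (a b x y : Bits M) :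
    Function.update (partialTest r a b x y) r 1 = partialTest r a b x y := by
  apply Function.update_eq_self_iff.2
  simp [partialTest]

lemma update_partialTest_testProj {M : ℕ} (r : Fin M) (a b x y : Bits M) :
    Function.update (partialTest r a b x y) r (testProj (a r) (b r) (x r) (y r)) =
      partialTest (r + 1) a b x y := by
  funext i
  by_cases hi : i = r
  · subst hi
    simp [partialTest]
  · rw [Function.update_of_ne hi]
    have : i.val < r.val ↔ i.val < r.val + 1 := by
      have : i.val ≠ r.val := fun h => hi (Fin.ext h)
      omega
    simp only [partialTest, this]

lemma partialTest_succ_of_le {M k : ℕ} (hk : M ≤ k) (a b x y : Bits M) :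
    partialTest (k + 1) a b x y = partialTest k a b x y := by
  funext i
  have := i.isLt
  simp only [partialTest, show i.val < k by omega, show i.val < k + 1 by omega]

section Device

variable {M : ℕ} {W Z : Type} [Fintype W] (D : Device M W Z)

/-- The probability that the outcomes are `a, b, w` and that Charlie's qubits pass the tests of
the runs below `k`. -/
def Device.passBelow (k : ℕ) (a b : Bits M) (w : W) (x y : Bits M) (z : Z) : ℝ :=
  (tensorOp (partialTest k a b x y) * D.op a b w x y z).trace.re

lemma Device.passBelow_nonneg (k : ℕ) (a b : Bits M) (w : W) (x y : Bits M) (z : Z) :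
    0 ≤ D.passBelow k a b w x y z :=
  re_trace_mul_nonneg (tensorOp_posSemidef (partialTest_posSemidef k a b x y)) (D.pos _ _ _ _ _ _)

lemma Device.passBelow_all (a b : Bits M) (w : W) (x y : Bits M) (z : Z) :
    D.passBelow M a b w x y z = D.passProb a b w x y z := by
  have : partialTest M a b x y = fun i => testProj (a i) (b i) (x i) (y i) :=
    funext fun i => if_pos i.isLt
  rw [passBelow, passProb, this]

lemma Device.passBelow_zero (a b : Bits M) (w : W) (x y : Bits M) (z : Z) :
    D.passBelow 0 a b w x y z = (D.op a b w x y z).trace.re := by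
  have : partialTest 0 a b x y = fun _ => 1 := funext fun i => if_neg (Nat.not_lt_zero _)
  rw [passBelow, this, tensorOp_one, one_mul]

lemma Device.passBelow_eq_reducedFunctional (r : Fin M) (a b : Bits M) (w : W) (x y : Bits M)
    (z : Z) : D.passBelow r a b w x y z =
      reducedFunctional (partialTest r a b x y) r (D.op a b w x y z) 1 := by
  rw [reducedFunctional_apply, update_partialTest_one, passBelow]

lemma Device.passBelow_succ_eq_reducedFunctional (r : Fin M) (a b : Bits M) (w : W)
    (x y : Bits M) (z : Z) : D.passBelow (r + 1) a b w x y z =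
      reducedFunctional (partialTest r a b x y) r (D.op a b w x y z)
        (testProj (a r) (b r) (x r) (y r)) := by
  rw [reducedFunctional_apply, update_partialTest_testProj, passBelow]

/-- One more test replaces a factor `1` by a projector below it; from `k = M` on there is nothing
left to test. This is the loss of mass in the martingale argument. -/
lemma Device.passBelow_succ_le (k : ℕ) (a b : Bits M) (w : W) (x y : Bits M) (z : Z) :
    D.passBelow (k + 1) a b w x y z ≤ D.passBelow k a b w x y z := by
  rcases lt_or_ge k M with hk | hk
  · have h1 := D.passBelow_eq_reducedFunctional ⟨k, hk⟩ a b w x y z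
    have h2 := D.passBelow_succ_eq_reducedFunctional ⟨k, hk⟩ a b w x y z
    simp only at h1 h2
    rw [h1, h2, ← sub_nonneg, ← map_sub]
    exact reducedFunctional_nonneg (partialTest_posSemidef _ _ _ _ _) (D.pos _ _ _ _ _ _)
      (one_sub_testProj_posSemidef _ _ _ _)
  · rw [passBelow, partialTest_succ_of_le hk, passBelow]

lemma Device.passBelow_antitone (a b : Bits M) (w : W) (x y : Bits M) (z : Z) :
    Antitone fun k => D.passBelow k a b w x y z :=
  antitone_nat_of_succ_le fun k => D.passBelow_succ_le k a b w x y z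

lemma Device.sum_passBelow_eve (k : ℕ) (a b x y : Bits M) (z z' : Z) :
    ∑ w, D.passBelow k a b w x y z = ∑ w, D.passBelow k a b w x y z' := by
  simp only [passBelow, ← Complex.re_sum, ← Matrix.trace_sum, ← Matrix.mul_sum,
    D.eve a b x y z z']

open Classical in
/-- What happens before run `k` does not depend on the settings from run `k` on. -/
lemma Device.sum_class_passBelow {k : ℕ} (a₀ b₀ : Bits M) (w : W) {x x' y y' : Bits M} (z : Z)
    (hx : AgreeBelow k x x') (hy : AgreeBelow k y y') :
    ∑ a with AgreeBelow k a a₀, ∑ b with AgreeBelow k b b₀, D.passBelow k a b w x y z =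
      ∑ a with AgreeBelow k a a₀, ∑ b with AgreeBelow k b b₀, D.passBelow k a b w x' y' z := by
  have pull : ∀ x₁ y₁, AgreeBelow k x x₁ → AgreeBelow k y y₁ →
      ∑ a with AgreeBelow k a a₀, ∑ b with AgreeBelow k b b₀, D.passBelow k a b w x₁ y₁ z =
      (tensorOp (partialTest k a₀ b₀ x y) * ∑ a with AgreeBelow k a a₀,
        ∑ b with AgreeBelow k b b₀, D.op a b w x₁ y₁ z).trace.re := by
    intro x₁ y₁ h₁ h₂
    simp only [Matrix.mul_sum, Matrix.trace_sum, Complex.re_sum]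
    refine Finset.sum_congr rfl fun a ha => Finset.sum_congr rfl fun b hb => ?_
    simp only [Finset.mem_filter, Finset.mem_univ, true_and] at ha hb
    rw [passBelow, partialTest_congr ha hb h₁.symm h₂.symm]
  rw [pull x y (.refl _ _) (.refl _ _), pull x' y' hx hy]
  congr 3
  rw [Finset.sum_comm, Finset.sum_congr rfl fun b _ => D.alice k a₀ b w x x' y z hx,
    Finset.sum_comm]
  exact Finset.sum_congr rfl fun a _ => D.bob k a b₀ w x' y y' z hy

lemma Device.sum_passBelow_congr {k : ℕ} (w : W) {x x' y y' : Bits M} (z : Z)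
    (hx : AgreeBelow k x x') (hy : AgreeBelow k y y') :
    ∑ a, ∑ b, D.passBelow k a b w x y z = ∑ a, ∑ b, D.passBelow k a b w x' y' z := by
  classical
  have key : ∀ f : Bits M → Bits M → ℝ, ∑ a, ∑ b, f a b = ∑ η ∈ prefixReps M k,
      ∑ θ ∈ prefixReps M k, ∑ a with AgreeBelow k a η, ∑ b with AgreeBelow k b θ, f a b := by
    intro f
    rw [← sum_prefixReps k]
    refine Finset.sum_congr rfl fun η _ => ?_
    exact (Finset.sum_congr rfl fun a _ => (sum_prefixReps k _).symm).trans Finset.sum_comm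
  rw [key, key]
  exact Finset.sum_congr rfl fun η _ => Finset.sum_congr rfl fun θ _ =>
    D.sum_class_passBelow η θ w z hx hy

/-- The bit `0` as `1` and the bit `1` as `-1`. -/
def bitSign (c : Fin 2) : ℝ := if c = 0 then 1 else -1

lemma abs_bitSign (c : Fin 2) : |bitSign c| = 1 := by
  rw [bitSign]; split_ifs <;> simp

lemma sum_bitSign_mul {ι : Type*} (s : Finset ι) (c : ι → Fin 2) (f : ι → ℝ) :
    ∑ i ∈ s, f i * bitSign (c i) = ∑ i ∈ s with c i = 0, f i - ∑ i ∈ s with c i = 1, f i := by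
  rw [← Finset.sum_fiberwise s c, Fin.sum_univ_two, sub_eq_add_neg, ← Finset.sum_neg_distrib]
  congr 1
  · refine Finset.sum_congr rfl fun i hi => ?_
    rw [(Finset.mem_filter.1 hi).2, bitSign, if_pos rfl, mul_one]
  · refine Finset.sum_congr rfl fun i hi => ?_
    rw [(Finset.mem_filter.1 hi).2, bitSign, if_neg (by decide), mul_neg_one]

open Classical in
/-- Given the outcomes of the runs below `r`, the bias of Alice's outcome in run `r` is controlled
by the probability of failing the test of that run for the settings `(0, 0)` and `(1, 0)`. -/
lemma Device.class_bias_le (r : Fin M) (a₀ b₀ : Bits M) (w : W) (x y : Bits M) (z : Z) :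
    |∑ a with AgreeBelow r a a₀, ∑ b with AgreeBelow r b b₀,
        D.passBelow r a b w x y z * bitSign (a r)| ≤
      4 * √((∑ a with AgreeBelow r a a₀, ∑ b with AgreeBelow r b b₀,
          D.passBelow r a b w (Function.update x r 0) (Function.update y r 0) z) *
        ∑ s, ∑ a with AgreeBelow r a a₀, ∑ b with AgreeBelow r b b₀,
          (D.passBelow r a b w (Function.update x r s) (Function.update y r 0) z -
            D.passBelow (r + 1) a b w (Function.update x r s) (Function.update y r 0) z)) := by
  set g := partialTest r a₀ b₀ x y with hg
  set A := Finset.univ.filter fun a => AgreeBelow r a a₀ with hA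
  set B := Finset.univ.filter fun b => AgreeBelow r b b₀ with hB
  have hAm : ∀ a ∈ A, AgreeBelow r a a₀ := fun a ha => (Finset.mem_filter.1 ha).2
  have hBm : ∀ b ∈ B, AgreeBelow r b b₀ := fun b hb => (Finset.mem_filter.1 hb).2
  set op : Fin 2 → Bits M → Bits M → QubitOp M := fun s a b =>
    D.op a b w (Function.update x r s) (Function.update y r 0) z with hop
  -- All strings of the class have the same tests below `r`, so one `g` serves them all and the
  -- class acts as a single run with outcomes `c, d`. Summing over outcomes after `r` is harmless as
  -- no later test is applied.
  set φ : Fin 2 → Fin 2 → Fin 2 → Matrix (Fin 2) (Fin 2) ℂ →ₗ[ℝ] ℝ := fun c d s =>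
    reducedFunctional g r (∑ a ∈ A with a r = c, ∑ b ∈ B with b r = d, op s a b) with hφ
  have hφ_apply : ∀ c d s T, φ c d s T = ∑ a ∈ A with a r = c, ∑ b ∈ B with b r = d,
      reducedFunctional g r (op s a b) T := fun c d s T => by
    simp only [hφ, reducedFunctional_sum]
  have hpos : ∀ c d s (T : Matrix (Fin 2) (Fin 2) ℂ), T.PosSemidef → 0 ≤ φ c d s T :=
    fun c d s T hT => by
      rw [hφ_apply]
      exact Finset.sum_nonneg fun a _ => Finset.sum_nonneg fun b _ =>
        reducedFunctional_nonneg (partialTest_posSemidef _ _ _ _ _) (D.pos _ _ _ _ _ _) hT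
  have hns : ∀ d T, ∑ c, φ c d 0 T = ∑ c, φ c d 1 T := fun d T => by
    have e : ∀ s, ∑ c, φ c d s T =
        reducedFunctional g r (∑ b ∈ B with b r = d, ∑ a ∈ A, op s a b) T := fun s => by
      simp only [hφ_apply, reducedFunctional_sum]
      rw [Finset.sum_fiberwise A (fun a => a r)
        (fun a => ∑ b ∈ B with b r = d, reducedFunctional g r (op s a b) T), Finset.sum_comm]
    have e' : ∑ b ∈ B with b r = d, ∑ a ∈ A, op 0 a b = ∑ b ∈ B with b r = d, ∑ a ∈ A, op 1 a b :=
      Finset.sum_congr rfl fun b _ => D.alice r a₀ b w _ _ _ z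
        ((agreeBelow_update x r 0).trans (agreeBelow_update x r 1).symm)
    rw [e, e, e']
  have hgen : ∀ s a b, a ∈ A → b ∈ B →
      partialTest r a b (Function.update x r s) (Function.update y r 0) = g := fun s a b ha hb =>
    partialTest_congr (hAm a ha) (hBm b hb) (agreeBelow_update x r s) (agreeBelow_update y r 0)
  have hpass : ∀ s a b, a ∈ A → b ∈ B →
      D.passBelow r a b w (Function.update x r s) (Function.update y r 0) z =
        reducedFunctional g r (op s a b) 1 := fun s a b ha hb => by
    rw [passBelow_eq_reducedFunctional, hgen s a b ha hb]
  have hpass' : ∀ s a b, a ∈ A → b ∈ B →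
      D.passBelow (r + 1) a b w (Function.update x r s) (Function.update y r 0) z =
        reducedFunctional g r (op s a b) (testProj (a r) (b r) s 0) := fun s a b ha hb => by
    rw [passBelow_succ_eq_reducedFunctional, hgen s a b ha hb, Function.update_self,
      Function.update_self]
  have split : ∀ f : Bits M → Bits M → ℝ, ∑ c, ∑ d, ∑ a ∈ A with a r = c, ∑ b ∈ B with b r = d,
      f a b = ∑ a ∈ A, ∑ b ∈ B, f a b := fun f => by
    rw [← Finset.sum_fiberwise A fun a => a r]
    refine Finset.sum_congr rfl fun c _ => ?_
    exact Finset.sum_comm.trans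
      (Finset.sum_congr rfl fun a _ => Finset.sum_fiberwise B (fun b => b r) _)
  have e1 : ∑ a ∈ A, ∑ b ∈ B, D.passBelow r a b w x y z * bitSign (a r) =
      ∑ d, φ 0 d (x r) 1 - ∑ d, φ 1 d (x r) 1 := by
    have h1 : ∀ a ∈ A, ∑ b ∈ B, D.passBelow r a b w x y z * bitSign (a r) =
        (∑ b ∈ B, reducedFunctional g r (op (x r) a b) 1) * bitSign (a r) := fun a ha => by
      rw [← Finset.sum_mul, ← reducedFunctional_sum]
      -- Bob's no-signaling resets `y r` to `0` without affecting Alice's statistics, so only the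
      -- tests with `y = 0` are needed even when the actual setting is `1`.
      have : ∑ b ∈ B, op (x r) a b = ∑ b ∈ B, D.op a b w x y z := by
        simp only [hop, Function.update_eq_self]
        exact D.bob r a b₀ w x _ _ z (agreeBelow_update y r 0)
      rw [this, reducedFunctional_sum]
      congr 1
      refine Finset.sum_congr rfl fun b hb => ?_
      rw [passBelow_eq_reducedFunctional,
        partialTest_congr (hAm a ha) (hBm b hb) (.refl _ x) (.refl _ y)]
    rw [Finset.sum_congr rfl h1, sum_bitSign_mul]
    simp only [hφ_apply]
    congr 1 <;>
    exact (Finset.sum_congr rfl fun a _ => (Finset.sum_fiberwise B (fun b => b r) _).symm).trans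
      Finset.sum_comm
  have e2 : ∑ a ∈ A, ∑ b ∈ B,
      D.passBelow r a b w (Function.update x r 0) (Function.update y r 0) z =
        ∑ c, ∑ d, φ c d 0 1 := by
    simp only [hφ_apply]
    rw [split]
    exact Finset.sum_congr rfl fun a ha => Finset.sum_congr rfl fun b hb => hpass 0 a b ha hb
  have e3 : ∀ s, ∑ a ∈ A, ∑ b ∈ B,
      (D.passBelow r a b w (Function.update x r s) (Function.update y r 0) z -
        D.passBelow (r + 1) a b w (Function.update x r s) (Function.update y r 0) z) =
        ∑ c, ∑ d, φ c d s (1 - testProj c d s 0) := fun s => by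
    rw [← split]
    refine Finset.sum_congr rfl fun c _ => Finset.sum_congr rfl fun d _ => ?_
    rw [hφ_apply]
    refine Finset.sum_congr rfl fun a ha => Finset.sum_congr rfl fun b hb => ?_
    obtain ⟨haA, rfl⟩ := Finset.mem_filter.1 ha
    obtain ⟨hbB, rfl⟩ := Finset.mem_filter.1 hb
    rw [hpass s a b haA hbB, hpass' s a b haA hbB, map_sub]
  rw [e1, e2, Finset.sum_congr rfl fun s _ => e3 s]
  exact run_bias_le φ hpos hns (x r)

end Device

/-! ### Alice's outcome in one run and the acceptance of all runs -/

/-- The prefixes of length `k` of a pair of strings. -/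
def prefixPair {M : ℕ} (k : ℕ) (ω : Bits M × Bits M) : Bits M × Bits M :=
  (truncBits k ω.1, truncBits k ω.2)

lemma prefixPair_eq_iff {M k : ℕ} {ω ω' : Bits M × Bits M} :
    prefixPair k ω = prefixPair k ω' ↔ AgreeBelow k ω.1 ω'.1 ∧ AgreeBelow k ω.2 ω'.2 := by
  rw [prefixPair, prefixPair, Prod.mk.injEq, truncBits_eq_iff, truncBits_eq_iff]

open Classical in
lemma sum_prefixPair_fiber {M k : ℕ} (ω₀ : Bits M × Bits M) (f : Bits M × Bits M → ℝ) :
    ∑ ω with prefixPair k ω = prefixPair k ω₀, f ω =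
      ∑ a with AgreeBelow k a ω₀.1, ∑ b with AgreeBelow k b ω₀.2, f (a, b) := by
  rw [← Finset.sum_product']
  refine Finset.sum_congr ?_ fun _ _ => rfl
  ext ω
  simp only [prefixPair_eq_iff, Finset.mem_filter, Finset.mem_univ, true_and, Finset.mem_product]

section Device

variable {M : ℕ} {W Z : Type} [Fintype W] (D : Device M W Z)

/-- The total bias of Alice's outcome in run `r`, conditioned on the outcomes of the runs below
`r` and on passing their tests. -/
def Device.drift (r : Fin M) (w : W) (x y : Bits M) (z : Z) : ℝ :=
  ∑ η, |∑ ω : Bits M × Bits M with prefixPair r ω = η,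
    D.passBelow r ω.1 ω.2 w x y z * bitSign (ω.1 r)|

/-- The probability that run `r` is the first one that fails its test. -/
def Device.failProb (r : ℕ) (x y : Bits M) (z : Z) : ℝ :=
  ∑ w, ∑ a, ∑ b, (D.passBelow r a b w x y z - D.passBelow (r + 1) a b w x y z)

/-- The probability that all runs pass their tests. -/
def Device.acceptProb (x y : Bits M) (z : Z) : ℝ := ∑ w, ∑ a, ∑ b, D.passProb a b w x y z

/-- The correlation of Alice's outcome in run `r` with the acceptance of all runs. -/
def Device.corr (r : Fin M) (w : W) (x y : Bits M) (z : Z) : ℝ :=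
  ∑ a, ∑ b, D.passProb a b w x y z * bitSign (a r)

lemma Device.sum_passBelow_zero (x y : Bits M) (z : Z) :
    ∑ w, ∑ a, ∑ b, D.passBelow 0 a b w x y z = 1 := by
  have h : ∑ w, ∑ a, ∑ b, D.passBelow 0 a b w x y z =
      (∑ a, ∑ b, ∑ w, (D.op a b w x y z).trace).re := by
    simp only [passBelow_zero, Complex.re_sum]
    rw [Finset.sum_comm]
    exact Finset.sum_congr rfl fun a _ => Finset.sum_comm
  rw [h, D.norm, Complex.one_re]

lemma Device.sum_passBelow_le_one (k : ℕ) (x y : Bits M) (z : Z) :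
    ∑ w, ∑ a, ∑ b, D.passBelow k a b w x y z ≤ 1 := by
  rw [← D.sum_passBelow_zero x y z]
  exact Finset.sum_le_sum fun w _ => Finset.sum_le_sum fun a _ => Finset.sum_le_sum fun b _ =>
    D.passBelow_antitone a b w x y z (Nat.zero_le k)

lemma Device.sum_passBelow_all (x y : Bits M) (z : Z) :
    ∑ w, ∑ a, ∑ b, D.passBelow M a b w x y z = D.acceptProb x y z := by
  simp only [passBelow_all, acceptProb]

lemma Device.sum_sum_passBelow_eve (k : ℕ) (x y : Bits M) (z z' : Z) :
    ∑ w, ∑ a, ∑ b, D.passBelow k a b w x y z = ∑ w, ∑ a, ∑ b, D.passBelow k a b w x y z' := by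
  have h : ∀ z, ∑ w, ∑ a, ∑ b, D.passBelow k a b w x y z =
      ∑ a, ∑ b, ∑ w, D.passBelow k a b w x y z := fun z => by
    rw [Finset.sum_comm]
    exact Finset.sum_congr rfl fun a _ => Finset.sum_comm
  rw [h, h]
  exact Finset.sum_congr rfl fun a _ => Finset.sum_congr rfl fun b _ =>
    D.sum_passBelow_eve k a b x y z z'

lemma Device.failProb_eq (r : ℕ) (x y : Bits M) (z : Z) :
    D.failProb r x y z = ∑ w, ∑ a, ∑ b, D.passBelow r a b w x y z -
      ∑ w, ∑ a, ∑ b, D.passBelow (r + 1) a b w x y z := by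
  simp only [failProb, Finset.sum_sub_distrib]

lemma Device.failProb_nonneg (r : ℕ) (x y : Bits M) (z : Z) : 0 ≤ D.failProb r x y z :=
  Finset.sum_nonneg fun w _ => Finset.sum_nonneg fun a _ => Finset.sum_nonneg fun b _ =>
    sub_nonneg.2 (D.passBelow_succ_le r a b w x y z)

/-- Eve's outcome is summed out, so her input drops out. This makes the drift bound uniform in `z`,
and the maximum over `z` inside the distances is then free. -/
lemma Device.failProb_eve (r : ℕ) (x y : Bits M) (z z' : Z) :
    D.failProb r x y z = D.failProb r x y z' := by
  rw [failProb_eq, failProb_eq, D.sum_sum_passBelow_eve r x y z z',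
    D.sum_sum_passBelow_eve (r + 1) x y z z']

/-- Time ordering enters here: the settings of later runs cannot influence a first failure in run
`r`. The source estimate for resetting the settings of run `r` requires this. -/
lemma Device.failProb_congr {r : ℕ} {x x' y y' : Bits M} (z : Z) (hx : AgreeBelow (r + 1) x x')
    (hy : AgreeBelow (r + 1) y y') : D.failProb r x y z = D.failProb r x' y' z := by
  rw [failProb_eq, failProb_eq, Finset.sum_congr rfl fun w _ =>
      D.sum_passBelow_congr w z (hx.mono (Nat.le_succ r)) (hy.mono (Nat.le_succ r)),
    Finset.sum_congr rfl fun w _ => D.sum_passBelow_congr w z hx hy]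

lemma Device.acceptProb_eve (x y : Bits M) (z z' : Z) :
    D.acceptProb x y z = D.acceptProb x y z' := by
  rw [← sum_passBelow_all, ← sum_passBelow_all, D.sum_sum_passBelow_eve M x y z z']

lemma Device.acceptProb_nonneg (x y : Bits M) (z : Z) : 0 ≤ D.acceptProb x y z := by
  rw [← sum_passBelow_all]
  exact Finset.sum_nonneg fun w _ => Finset.sum_nonneg fun a _ => Finset.sum_nonneg fun b _ =>
    D.passBelow_nonneg M a b w x y z

lemma Device.acceptProb_le_one (x y : Bits M) (z : Z) : D.acceptProb x y z ≤ 1 := by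
  rw [← sum_passBelow_all]
  exact D.sum_passBelow_le_one M x y z

lemma Device.sum_failProb (x y : Bits M) (z : Z) :
    ∑ r : Fin M, D.failProb r x y z = 1 - D.acceptProb x y z := by
  rw [Fin.sum_univ_eq_sum_range (fun r => D.failProb r x y z), ← sum_passBelow_all,
    ← D.sum_passBelow_zero x y z]
  simp only [failProb_eq]
  exact Finset.sum_range_sub' _ M

/-- The drift is controlled by the probabilities to fail the test of run `r` for the settings
`(0, 0)` and `(1, 0)`, whatever Eve's input. -/
lemma Device.sum_drift_le (r : Fin M) (x y : Bits M) (z : Z) :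
    ∑ w, D.drift r w x y z ≤
      4 * √(∑ s, D.failProb r (Function.update x r s) (Function.update y r 0) z) := by
  classical
  set P : W → Bits M × Bits M → ℝ := fun w ω =>
    D.passBelow r ω.1 ω.2 w (Function.update x r 0) (Function.update y r 0) z with hP
  set F : Fin 2 → W → Bits M × Bits M → ℝ := fun s w ω =>
    D.passBelow r ω.1 ω.2 w (Function.update x r s) (Function.update y r 0) z -
      D.passBelow (r + 1) ω.1 ω.2 w (Function.update x r s) (Function.update y r 0) z with hF
  have hP0 : ∀ w ω, 0 ≤ P w ω := fun w ω => D.passBelow_nonneg _ _ _ _ _ _ _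
  have hF0 : ∀ s w ω, 0 ≤ F s w ω := fun s w ω => sub_nonneg.2 (D.passBelow_succ_le _ _ _ _ _ _ _)
  have key : ∀ w η, |∑ ω : Bits M × Bits M with prefixPair r ω = η,
      D.passBelow r ω.1 ω.2 w x y z * bitSign (ω.1 r)| ≤
      4 * √((∑ ω with prefixPair r ω = η, P w ω) *
        ∑ ω with prefixPair r ω = η, ∑ s, F s w ω) := by
    intro w η
    rcases (Finset.univ.filter fun ω => prefixPair r ω = η).eq_empty_or_nonempty with h | ⟨ω₀, h⟩
    · simp only [h, Finset.sum_empty, abs_zero]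
      positivity
    · obtain rfl : prefixPair r ω₀ = η := by simpa using h
      rw [Finset.sum_comm]
      simp only [sum_prefixPair_fiber]
      exact D.class_bias_le r ω₀.1 ω₀.2 w x y z
  calc ∑ w, D.drift r w x y z
      ≤ ∑ w, ∑ η, 4 * √((∑ ω with prefixPair r ω = η, P w ω) *
          ∑ ω with prefixPair r ω = η, ∑ s, F s w ω) :=
        Finset.sum_le_sum fun w _ => Finset.sum_le_sum fun η _ => key w η
    _ = 4 * ∑ c : W × (Bits M × Bits M), √((∑ ω with prefixPair r ω = c.2, P c.1 ω) *
          ∑ ω with prefixPair r ω = c.2, ∑ s, F s c.1 ω) := by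
        rw [Fintype.sum_prod_type, Finset.mul_sum]
        exact Finset.sum_congr rfl fun w _ => (Finset.mul_sum _ _ _).symm
    _ ≤ 4 * √((∑ c : W × (Bits M × Bits M), ∑ ω with prefixPair r ω = c.2, P c.1 ω) *
          ∑ c : W × (Bits M × Bits M), ∑ ω with prefixPair r ω = c.2, ∑ s, F s c.1 ω) := by
        refine mul_le_mul_of_nonneg_left (sum_sqrt_mul_le _ _ _ ?_ ?_) (by norm_num)
        · exact fun c _ => Finset.sum_nonneg fun ω _ => hP0 _ _
        · exact fun c _ => Finset.sum_nonneg fun ω _ => Finset.sum_nonneg fun s _ => hF0 _ _ _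
    _ = 4 * √((∑ w, ∑ ω, P w ω) * ∑ w, ∑ ω, ∑ s, F s w ω) := by
        simp only [Fintype.sum_prod_type (α₁ := W), Finset.sum_fiberwise]
    -- The first factor is a total probability for one choice of settings, hence at most `1`.
    _ ≤ 4 * √(∑ w, ∑ ω, ∑ s, F s w ω) := by
        refine mul_le_mul_of_nonneg_left (Real.sqrt_le_sqrt ?_) (by norm_num)
        refine mul_le_of_le_one_left (Finset.sum_nonneg fun w _ => Finset.sum_nonneg fun ω _ =>
          Finset.sum_nonneg fun s _ => hF0 _ _ _) ?_
        simp only [Fintype.sum_prod_type (α₁ := Bits M), hP]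
        exact D.sum_passBelow_le_one _ _ _ _
    _ = _ := by
        congr 2
        simp only [Device.failProb, Fintype.sum_prod_type (α₁ := Bits M), hF]
        rw [Finset.sum_comm (s := (Finset.univ : Finset (Fin 2)))]
        refine Finset.sum_congr rfl fun w _ => ?_
        rw [Finset.sum_comm (s := (Finset.univ : Finset (Fin 2)))]
        refine Finset.sum_congr rfl fun a _ => ?_
        rw [Finset.sum_comm]

/-- Dropping the tests from run `r` on costs at most the rejection probability. -/
lemma Device.sum_abs_corr_le (r : Fin M) (x y : Bits M) (z : Z) :
    ∑ w, |D.corr r w x y z| ≤ ∑ w, D.drift r w x y z + (1 - D.acceptProb x y z) := by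
  have h1 : ∀ w, |D.corr r w x y z| ≤ D.drift r w x y z +
      (∑ a, ∑ b, D.passBelow 0 a b w x y z - ∑ a, ∑ b, D.passBelow M a b w x y z) := by
    intro w
    -- The weight lost between run `r` and the end is at most the weight lost from the start to the
    -- end, whose sum over `w` is the rejection probability.
    have e : D.corr r w x y z = ∑ a, ∑ b, D.passBelow r a b w x y z * bitSign (a r) -
        ∑ a, ∑ b, (D.passBelow r a b w x y z - D.passBelow M a b w x y z) * bitSign (a r) := by
      simp only [corr, passBelow_all, ← Finset.sum_sub_distrib]
      exact Finset.sum_congr rfl fun a _ => Finset.sum_congr rfl fun b _ => by ring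
    rw [e]
    refine (abs_sub _ _).trans (add_le_add ?_ ?_)
    · rw [← Fintype.sum_prod_type' (f := fun a b => D.passBelow r a b w x y z * bitSign (a r)),
        ← Finset.sum_fiberwise Finset.univ (prefixPair r)]
      exact Finset.abs_sum_le_sum_abs _ _
    · simp only [← Finset.sum_sub_distrib]
      refine (Finset.abs_sum_le_sum_abs _ _).trans (Finset.sum_le_sum fun a _ => ?_)
      refine (Finset.abs_sum_le_sum_abs _ _).trans (Finset.sum_le_sum fun b _ => ?_)
      have hM := D.passBelow_antitone a b w x y z r.isLt.le
      have h0 := D.passBelow_antitone a b w x y z (Nat.zero_le r)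
      simp only at hM h0
      rw [abs_mul, abs_bitSign, mul_one, abs_of_nonneg (sub_nonneg.2 hM)]
      linarith
  refine (Finset.sum_le_sum fun w _ => h1 w).trans (le_of_eq ?_)
  rw [Finset.sum_add_distrib, Finset.sum_sub_distrib, sum_passBelow_zero, sum_passBelow_all]

/-- Up to the drift, the correlations of Alice's outcomes with the acceptance are square
summable over the runs. -/
lemma Device.sum_mul_abs_corr_le (t : Fin M → ℝ) (ht : ∀ r, 0 ≤ t r) (x y : Bits M) (z : Z) :
    ∑ r, t r * ∑ w, |D.corr r w x y z| ≤
      2 * √(∑ r, t r ^ 2) + ∑ r, t r * ∑ w, D.drift r w x y z := by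
  set q : W → ℕ → Bits M × Bits M → ℝ := fun w k ω => D.passBelow k ω.1 ω.2 w x y z with hq
  -- The martingale lemmas run over `ℕ`; signs and weights are extended by zero beyond the last run.
  set χ : ℕ → Bits M × Bits M → ℝ := fun k ω => if h : k < M then bitSign (ω.1 ⟨k, h⟩) else 0
    with hχ
  set T : ℕ → ℝ := fun k => if h : k < M then t ⟨k, h⟩ else 0 with hT
  set β : W → Fin M → Bits M × Bits M → ℝ := fun w r => condMean (prefixPair r) (q w r) (χ r)
    with hβ
  have hχr : ∀ (r : Fin M) ω, χ r ω = bitSign (ω.1 r) := fun r ω => by simp [hχ]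
  have hTr : ∀ r : Fin M, T r = t r := fun r => by simp [hT]
  have hq0 : ∀ w k ω, 0 ≤ q w k ω := fun w k ω => D.passBelow_nonneg _ _ _ _ _ _ _
  have bessel : ∀ w, ∑ r, t r * |∑ ω, q w M ω * (χ r ω - β w r ω)| ≤
      2 * √(∑ r, t r ^ 2) * ∑ a, ∑ b, D.passBelow 0 a b w x y z := by
    intro w
    have h := sum_mul_abs_fluctuation_le (π := prefixPair) (q := q w) (χ := χ)
      (fun k ω ω' h => by
        rw [prefixPair_eq_iff] at h ⊢
        exact ⟨h.1.mono (Nat.le_succ k), h.2.mono (Nat.le_succ k)⟩)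
      (hq0 w) (fun k ω => D.passBelow_succ_le _ _ _ _ _ _ _)
      (fun k ω => by
        simp only [hχ]
        split_ifs
        · exact (abs_bitSign _).le
        · simp)
      (fun k ω ω' h => by
        rw [prefixPair_eq_iff] at h
        simp only [hχ]
        split_ifs with hk
        · rw [h.1 ⟨k, hk⟩ (Nat.lt_succ_self k)]
        · rfl)
      T M
    rw [← Fin.sum_univ_eq_sum_range (fun k => T k ^ 2), ← Fin.sum_univ_eq_sum_range
      (fun k => T k * |∑ ω, q w M ω * (χ k ω - condMean (prefixPair k) (q w k) (χ k) ω)|)] at h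
    simp only [hTr] at h
    rwa [Fintype.sum_prod_type] at h
  have hcorr : ∀ r w, |D.corr r w x y z| ≤
      |∑ ω, q w M ω * (χ r ω - β w r ω)| + D.drift r w x y z := by
    intro r w
    -- Fluctuation plus predictable part, both under the final weight. Bessel handles the first; in
    -- the second, `q w M ≤ q w r` restores the weight for which the drift is defined.
    have e : D.corr r w x y z = ∑ ω, q w M ω * (χ r ω - β w r ω) + ∑ ω, q w M ω * β w r ω := by
      rw [← Finset.sum_add_distrib, corr,
        ← Fintype.sum_prod_type' (f := fun a b => D.passProb a b w x y z * bitSign (a r))]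
      refine Finset.sum_congr rfl fun ω _ => ?_
      rw [hχr, ← passBelow_all]
      simp only [hq]
      ring
    rw [e]
    refine (abs_add_le _ _).trans (add_le_add_right ?_ _)
    calc |∑ ω, q w M ω * β w r ω| ≤ ∑ ω, |q w M ω * β w r ω| := Finset.abs_sum_le_sum_abs _ _
      _ ≤ ∑ ω, q w r ω * |β w r ω| := by
          refine Finset.sum_le_sum fun ω _ => ?_
          rw [abs_mul, abs_of_nonneg (hq0 w M ω)]
          exact mul_le_mul_of_nonneg_right (D.passBelow_antitone _ _ _ _ _ _ r.isLt.le)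
            (abs_nonneg _)
      _ ≤ _ := by
          refine (sum_mul_abs_condMean_le (hq0 w r)).trans (le_of_eq ?_)
          simp only [hχr, drift, hq]
  calc ∑ r, t r * ∑ w, |D.corr r w x y z|
      ≤ ∑ r, t r * ∑ w, (|∑ ω, q w M ω * (χ r ω - β w r ω)| + D.drift r w x y z) :=
        Finset.sum_le_sum fun r _ => mul_le_mul_of_nonneg_left
          (Finset.sum_le_sum fun w _ => hcorr r w) (ht r)
    _ = ∑ w, ∑ r, t r * |∑ ω, q w M ω * (χ r ω - β w r ω)|
          + ∑ r, t r * ∑ w, D.drift r w x y z := by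
        rw [Finset.sum_comm, ← Finset.sum_add_distrib]
        refine Finset.sum_congr rfl fun r _ => ?_
        rw [Finset.sum_add_distrib, mul_add, Finset.mul_sum]
    _ ≤ ∑ w, 2 * √(∑ r, t r ^ 2) * ∑ a, ∑ b, D.passBelow 0 a b w x y z
          + ∑ r, t r * ∑ w, D.drift r w x y z :=
        add_le_add_left (Finset.sum_le_sum fun w _ => bessel w) _
    _ = _ := by rw [← Finset.mul_sum, sum_passBelow_zero, mul_one]

end Device

/-! ### Santha–Vazirani sources -/

lemma prefixWeight_congr {n : ℕ} {E : Type} (p : Bits n → E → ℝ) {k : ℕ} {s t : Bits n}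
    (h : AgreeBelow k s t) (e : E) : prefixWeight p k s e = prefixWeight p k t e := by
  rw [prefixWeight, prefixWeight]
  refine Finset.sum_congr ?_ fun _ _ => rfl
  ext r
  simp only [Finset.mem_filter, Finset.mem_univ, true_and]
  exact ⟨fun h' => h'.trans h, fun h' => h'.trans h.symm⟩

open Classical in
lemma filter_agreeBelow_succ {n : ℕ} (k : Fin n) (s : Bits n) (c : Fin 2) :
    (Finset.univ.filter fun t : Bits n => AgreeBelow (k + 1) t (Function.update s k c)) =
      (Finset.univ.filter fun t : Bits n => AgreeBelow k t s).filter fun t => t k = c := by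
  ext t
  simp only [Finset.mem_filter, Finset.mem_univ, true_and, agreeBelow_succ_iff,
    Function.update_self]
  exact and_congr_left fun _ => ⟨fun h => h.trans (agreeBelow_update s k c),
    fun h => h.trans (agreeBelow_update s k c).symm⟩

lemma prefixWeight_eq_sum {n : ℕ} {E : Type} (p : Bits n → E → ℝ) (k : Fin n) (s : Bits n)
    (e : E) : prefixWeight p k s e = ∑ c, prefixWeight p (k + 1) (Function.update s k c) e := by
  classical
  simp only [prefixWeight, filter_agreeBelow_succ]
  exact (Finset.sum_fiberwise _ (fun t : Bits n => t k) _).symm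

lemma prefixWeight_of_le {n : ℕ} {E : Type} (p : Bits n → E → ℝ) {k : ℕ} (hk : n ≤ k)
    (s : Bits n) (e : E) : prefixWeight p k s e = p s e := by
  classical
  rw [prefixWeight]
  have : (Finset.univ.filter fun t : Bits n => AgreeBelow k t s) = {s} := by
    ext t
    simp only [Finset.mem_filter, Finset.mem_univ, true_and, Finset.mem_singleton]
    exact ⟨fun h => h.eq hk, fun h => h ▸ AgreeBelow.refl _ _⟩
  rw [this, Finset.sum_singleton]

lemma prefixWeight_append {n m : ℕ} {E : Type} (p : Bits (n + m) → E → ℝ) (u : Bits n)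
    (v : Bits m) (e : E) :
    prefixWeight p n (Fin.append u v) e = ∑ v', p (Fin.append u v') e := by
  classical
  rw [prefixWeight, Finset.sum_filter, ← (Fin.appendEquiv n m).sum_comp, Fintype.sum_prod_type,
    Finset.sum_eq_single u]
  · refine Finset.sum_congr rfl fun v' _ => if_pos ?_
    intro i hi
    obtain ⟨j, rfl⟩ : ∃ j : Fin n, i = Fin.castAdd m j := ⟨⟨i.val, hi⟩, rfl⟩
    simp [Fin.appendEquiv]
  · intro u' _ hu'
    refine Finset.sum_eq_zero fun v' _ => if_neg fun h => hu' ?_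
    funext i
    simpa [Fin.appendEquiv] using h (Fin.castAdd m i) i.isLt
  · intro h
    exact absurd (Finset.mem_univ u) h

namespace SVSource

variable {ε : ℝ} {n : ℕ} {E : Type} [Fintype E] (S : SVSource ε n E)

/-- The definition of the source constrains only the bit `0`. The weight of the bit `1` is the
complement, and the interval is symmetric about `1/2`. -/
lemma prefixWeight_succ_bounds (k : Fin n) (s : Bits n) (e : E) :
    (1 / 2 - ε) * prefixWeight S.prob k s e ≤ prefixWeight S.prob (k + 1) s e ∧
      prefixWeight S.prob (k + 1) s e ≤ (1 / 2 + ε) * prefixWeight S.prob k s e := by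
  have hs : s k = 0 ∨ s k = 1 := by omega
  rcases hs with hs | hs
  · exact S.sv k s e hs
  · have h := S.sv k (Function.update s k 0) e (Function.update_self _ _ _)
    rw [prefixWeight_congr S.prob (agreeBelow_update s k 0)] at h
    have h2 := prefixWeight_eq_sum S.prob k s e
    have h3 : Function.update s k 1 = s := by rw [← hs, Function.update_eq_self]
    rw [Fin.sum_univ_two, h3] at h2
    constructor <;> linarith [h.1, h.2]

lemma prefixWeight_add_le (hε : 0 ≤ 1 / 2 + ε) (k i : ℕ) (hi : k + i ≤ n) (s : Bits n) (e : E) :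
    prefixWeight S.prob (k + i) s e ≤ (1 / 2 + ε) ^ i * prefixWeight S.prob k s e := by
  induction i with
  | zero => simp
  | succ i ih =>
    have h := (S.prefixWeight_succ_bounds ⟨k + i, by omega⟩ s e).2
    have h2 := mul_le_mul_of_nonneg_left (ih (by omega)) hε
    rw [pow_succ']
    simp only at h
    rw [← add_assoc]
    linarith

/-- The conditional min-entropy of the last `m` bits. -/
lemma prob_append_le {k m : ℕ} (S : SVSource ε (k + m) E) (hε : 0 ≤ 1 / 2 + ε) (u : Bits k)
    (v : Bits m) (e : E) :
    S.prob (Fin.append u v) e ≤ (1 / 2 + ε) ^ m * ∑ v', S.prob (Fin.append u v') e := by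
  rw [← prefixWeight_append S.prob u v, ← prefixWeight_of_le S.prob le_rfl]
  exact S.prefixWeight_add_le hε k m le_rfl _ e

/-- Replacing one bit by a constant increases the mean of a function of the bits up to that one
by a bounded factor at most. -/
lemma sum_update_le (k : Fin n) (c : Fin 2) (e : E) (g : Bits n → ℝ) (hg₀ : ∀ s, 0 ≤ g s)
    (hg : ∀ s t, AgreeBelow (k + 1) s t → g s = g t) :
    (1 / 2 - ε) * ∑ s, S.prob s e * g (Function.update s k c) ≤ ∑ s, S.prob s e * g s := by
  classical
  rw [← sum_prefixReps k, ← sum_prefixReps (k : ℕ) fun s => S.prob s e * g s, Finset.mul_sum]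
  refine Finset.sum_le_sum fun η _ => ?_
  calc (1 / 2 - ε) * ∑ s with AgreeBelow k s η, S.prob s e * g (Function.update s k c)
      = (1 / 2 - ε) * prefixWeight S.prob k (Function.update η k c) e *
          g (Function.update η k c) := by
        rw [prefixWeight_congr S.prob (agreeBelow_update η k c), prefixWeight, mul_assoc,
          Finset.sum_mul]
        congr 1
        refine Finset.sum_congr rfl fun s hs => ?_
        have hs : AgreeBelow k s η := (Finset.mem_filter.1 hs).2
        rw [hg (Function.update s k c) (Function.update η k c)]
        exact agreeBelow_succ_iff.2 ⟨((agreeBelow_update s k c).trans hs).trans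
          (agreeBelow_update η k c).symm, by simp⟩
    _ ≤ prefixWeight S.prob (k + 1) (Function.update η k c) e * g (Function.update η k c) :=
        mul_le_mul_of_nonneg_right (S.prefixWeight_succ_bounds k _ e).1 (hg₀ _)
    _ = ∑ s with AgreeBelow (k + 1) s (Function.update η k c), S.prob s e * g s := by
        rw [prefixWeight, Finset.sum_mul]
        refine Finset.sum_congr rfl fun s hs => ?_
        rw [hg s _ (Finset.mem_filter.1 hs).2]
    _ ≤ ∑ s with AgreeBelow k s η, S.prob s e * g s := by
        rw [filter_agreeBelow_succ]
        exact Finset.sum_le_sum_of_subset_of_nonneg (Finset.filter_subset _ _)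
          fun s _ _ => mul_nonneg (S.nonneg s e) (hg₀ s)

end SVSource

/-! ### The settings of one run -/

section Settings

variable {M : ℕ}

lemma aliceSetting_update_even (u : Bits (2 * M)) (r : Fin M) (c : Fin 2) :
    aliceSetting (Function.update u ⟨2 * r, by omega⟩ c) =
      Function.update (aliceSetting u) r c := by
  funext i
  simp only [aliceSetting, Function.update_apply, Fin.ext_iff]
  congr 1
  simp

lemma aliceSetting_update_odd (u : Bits (2 * M)) (r : Fin M) (c : Fin 2) :
    aliceSetting (Function.update u ⟨2 * r + 1, by omega⟩ c) = aliceSetting u := by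
  funext i
  simp only [aliceSetting, Function.update_apply, Fin.mk.injEq]
  rw [if_neg (by omega)]

lemma bobSetting_update_even (u : Bits (2 * M)) (r : Fin M) (c : Fin 2) :
    bobSetting (Function.update u ⟨2 * r, by omega⟩ c) = bobSetting u := by
  funext i
  simp only [bobSetting, Function.update_apply, Fin.mk.injEq]
  rw [if_neg (by omega)]

lemma bobSetting_update_odd (u : Bits (2 * M)) (r : Fin M) (c : Fin 2) :
    bobSetting (Function.update u ⟨2 * r + 1, by omega⟩ c) =
      Function.update (bobSetting u) r c := by
  funext i
  simp only [bobSetting, Function.update_apply, Fin.ext_iff]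
  congr 1
  simp

lemma agreeBelow_aliceSetting {k : ℕ} {u u' : Bits (2 * M)} (h : AgreeBelow (2 * k) u u') :
    AgreeBelow k (aliceSetting u) (aliceSetting u') :=
  fun i hi => h ⟨2 * i, by omega⟩ (by simp only; omega)

lemma agreeBelow_bobSetting {k : ℕ} {u u' : Bits (2 * M)} (h : AgreeBelow (2 * k) u u') :
    AgreeBelow k (bobSetting u) (bobSetting u') :=
  fun i hi => h ⟨2 * i + 1, by omega⟩ (by simp only; omega)

/-- Every pair of settings of a run occurs with a conditional probability bounded below. -/
lemma sum_update_settings_le {ε : ℝ} (hε : ε ≤ 1 / 2) {m : ℕ} {E : Type} [Fintype E]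
    (S : SVSource ε (2 * M + m) E) (r : Fin M) (c d : Fin 2) (e : E)
    (g : Bits M → Bits M → ℝ) (hg₀ : ∀ x y, 0 ≤ g x y)
    (hg : ∀ x x' y y', AgreeBelow (r + 1) x x' → AgreeBelow (r + 1) y y' → g x y = g x' y') :
    (1 / 2 - ε) ^ 2 * ∑ u, ∑ v, S.prob (Fin.append u v) e *
        g (Function.update (aliceSetting u) r c) (Function.update (bobSetting u) r d) ≤
      ∑ u, ∑ v, S.prob (Fin.append u v) e * g (aliceSetting u) (bobSetting u) := by
  set U : Bits (2 * M + m) → Bits (2 * M) := fun s i => s (Fin.castAdd m i) with hU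
  set G : Bits (2 * M + m) → ℝ := fun s => g (aliceSetting (U s)) (bobSetting (U s)) with hG
  have hUagree : ∀ (k : ℕ) s t, AgreeBelow k s t → AgreeBelow k (U s) (U t) :=
    fun k s t h i hi => h (Fin.castAdd m i) hi
  have hUupd : ∀ s (i : Fin (2 * M)) c, U (Function.update s (Fin.castAdd m i) c) =
      Function.update (U s) i c := fun s i c => by
    funext j
    simp [hU, Function.update_apply]
  have conv : ∀ f : Bits (2 * M) → ℝ, ∑ u, ∑ v, S.prob (Fin.append u v) e * f u =
      ∑ s, S.prob s e * f (U s) := fun f => by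
    rw [← (Fin.appendEquiv (2 * M) m).sum_comp, Fintype.sum_prod_type]
    refine Finset.sum_congr rfl fun u _ => Finset.sum_congr rfl fun v _ => ?_
    simp [Fin.appendEquiv, hU]
  rw [conv fun u => g (Function.update (aliceSetting u) r c) (Function.update (bobSetting u) r d),
    conv fun u => g (aliceSetting u) (bobSetting u)]
  set k₀ : Fin (2 * M + m) := Fin.castAdd m ⟨2 * r, by omega⟩ with hk₀
  set k₁ : Fin (2 * M + m) := Fin.castAdd m ⟨2 * r + 1, by omega⟩ with hk₁
  have hGagree : ∀ s t, AgreeBelow (2 * (r + 1)) s t → G s = G t := fun s t h =>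
    hg _ _ _ _ (agreeBelow_aliceSetting (hUagree _ s t h))
      (agreeBelow_bobSetting (hUagree _ s t h))
  -- Bob's bit, the later one, is reset first. Afterwards the function no longer depends on it, so
  -- it depends on bits up to Alice's only and the estimate applies again.
  have h1 := S.sum_update_le k₁ d e G (fun s => hg₀ _ _) hGagree
  have h2 := S.sum_update_le k₀ c e (fun s => G (Function.update s k₁ d)) (fun s => hg₀ _ _)
    (fun s t h => hGagree _ _ (by
      change AgreeBelow (k₁ + 1) _ _
      refine agreeBelow_succ_iff.2 ⟨?_, by simp⟩
      exact ((agreeBelow_update s k₁ d).trans h).trans (agreeBelow_update t k₁ d).symm))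
  have e1 : ∀ s, G (Function.update (Function.update s k₀ c) k₁ d) =
      g (Function.update (aliceSetting (U s)) r c) (Function.update (bobSetting (U s)) r d) :=
    fun s => by
      simp only [hG, hk₀, hk₁, hUupd, aliceSetting_update_odd, aliceSetting_update_even,
        bobSetting_update_odd, bobSetting_update_even]
  simp only [e1] at h2
  have h3 := mul_le_mul_of_nonneg_left h2 (sub_nonneg.2 hε)
  rw [sq, mul_assoc]
  linarith

end Settings

/-! ### The protocol -/

section Protocol

variable {ε : ℝ} {m : ℕ} {W Z E : Type} [Fintype W] [Fintype E]
  (D : Device (2 ^ m) W Z) (S : SVSource ε (2 * 2 ^ m + m) E)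

lemma SVSource.sum_prob_append {ε : ℝ} {k m : ℕ} {E : Type} [Fintype E]
    (S : SVSource ε (k + m) E) : ∑ u, ∑ v, ∑ e, S.prob (Fin.append u v) e = 1 := by
  rw [← S.sum_one, ← (Fin.appendEquiv k m).sum_comp, Fintype.sum_prod_type]
  rfl

lemma sum_ite_outcome {M : ℕ} (r : Fin M) (f : Bits M → Bits M → ℝ) :
    ∑ s, ∑ a, ∑ b, (if a r = s then f a b else 0) = ∑ a, ∑ b, f a b := by
  rw [Finset.sum_comm]
  refine Finset.sum_congr rfl fun a _ => ?_
  rw [Finset.sum_comm]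
  exact Finset.sum_congr rfl fun b _ => by simp

lemma sum_jointProb (u : Bits (2 * 2 ^ m)) (v : Bits m) (e : E) (w : W) (z : Z) :
    ∑ s, jointProb D S s u v e w z = S.prob (Fin.append u v) e *
      ∑ a, ∑ b, D.passProb a b w (aliceSetting u) (bobSetting u) z := by
  simp only [jointProb]
  rw [← Finset.mul_sum, sum_ite_outcome]

lemma jointProb_zero_sub_one (u : Bits (2 * 2 ^ m)) (v : Bits m) (e : E) (w : W) (z : Z) :
    jointProb D S 0 u v e w z - jointProb D S 1 u v e w z = S.prob (Fin.append u v) e *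
      D.corr (selectedRun v) w (aliceSetting u) (bobSetting u) z := by
  rw [jointProb, jointProb, ← mul_sub, Device.corr]
  simp only [← Finset.sum_sub_distrib]
  congr 1
  refine Finset.sum_congr rfl fun a _ => Finset.sum_congr rfl fun b _ => ?_
  have : a (selectedRun v) = 0 ∨ a (selectedRun v) = 1 := by omega
  rcases this with h | h <;> simp [h, bitSign]

lemma accProb_eq (z : Z) : accProb D S z = ∑ u, ∑ v, ∑ e, S.prob (Fin.append u v) e *
    D.acceptProb (aliceSetting u) (bobSetting u) z := by
  rw [accProb, Finset.sum_comm]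
  refine Finset.sum_congr rfl fun u _ => ?_
  rw [Finset.sum_comm]
  refine Finset.sum_congr rfl fun v _ => ?_
  rw [Finset.sum_comm]
  refine Finset.sum_congr rfl fun e _ => ?_
  rw [Finset.sum_comm, Device.acceptProb, Finset.mul_sum]
  exact Finset.sum_congr rfl fun w _ => sum_jointProb D S u v e w z

lemma accProb_eve (z z' : Z) : accProb D S z = accProb D S z' := by
  rw [accProb_eq, accProb_eq]
  simp only [D.acceptProb_eve _ _ z z']

lemma accProb_nonneg (z : Z) : 0 ≤ accProb D S z := by
  rw [accProb_eq]
  exact Finset.sum_nonneg fun u _ => Finset.sum_nonneg fun v _ => Finset.sum_nonneg fun e _ =>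
    mul_nonneg (S.nonneg _ _) (D.acceptProb_nonneg _ _ _)

lemma one_sub_accProb (z : Z) : 1 - accProb D S z = ∑ u, ∑ v, ∑ e, S.prob (Fin.append u v) e *
    (1 - D.acceptProb (aliceSetting u) (bobSetting u) z) := by
  simp only [mul_sub, mul_one, Finset.sum_sub_distrib, S.sum_prob_append, accProb_eq]

lemma accProb_le_one (z : Z) : accProb D S z ≤ 1 := by
  rw [← sub_nonneg, one_sub_accProb]
  exact Finset.sum_nonneg fun u _ => Finset.sum_nonneg fun v _ => Finset.sum_nonneg fun e _ =>
    mul_nonneg (S.nonneg _ _) (sub_nonneg.2 (D.acceptProb_le_one _ _ _))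

/-- For a binary output both deviations equal half the difference of the two joint probabilities.
The acceptance probability does not depend on Eve's input, so `z'` may be fixed while `z` varies
under the supremum. -/
lemma accProb_mul_deviation_le (s : Fin 2) (u : Bits (2 * 2 ^ m)) (v : Bits m) (e : E) (w : W)
    (z z' : Z) : accProb D S z' * deviation D S s u v e w z ≤
      1 / 2 * (S.prob (Fin.append u v) e *
        |D.corr (selectedRun v) w (aliceSetting u) (bobSetting u) z|) := by
  rw [accProb_eve D S z' z]
  have h0 := accProb_nonneg D S z
  have hP := S.nonneg (Fin.append u v) e
  rcases h0.eq_or_lt with h | h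
  -- If the protocol never accepts, the left side vanishes whatever value the division by zero
  -- takes.
  · rw [← h, zero_mul]
    positivity
  · have e1 : |jointProb D S s u v e w z - 1 / 2 * ∑ s', jointProb D S s' u v e w z| =
        1 / 2 * |jointProb D S 0 u v e w z - jointProb D S 1 u v e w z| := by
      rw [Fin.sum_univ_two]
      have hs : s = 0 ∨ s = 1 := by omega
      rcases hs with rfl | rfl
      · rw [← abs_of_pos (show (0 : ℝ) < 1 / 2 by norm_num), ← abs_mul,
          abs_of_pos (show (0 : ℝ) < 1 / 2 by norm_num)]
        congr 1
        ring
      · rw [abs_sub_comm (jointProb D S 0 u v e w z),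
          ← abs_of_pos (show (0 : ℝ) < 1 / 2 by norm_num), ← abs_mul,
          abs_of_pos (show (0 : ℝ) < 1 / 2 by norm_num)]
        congr 1
        ring
    have e2 : accProb D S z * deviation D S s u v e w z =
        |jointProb D S s u v e w z - 1 / 2 * ∑ s', jointProb D S s' u v e w z| := by
      rw [deviation]
      simp only [condProb]
      rw [← Finset.sum_div]
      nth_rewrite 1 [← abs_of_pos h]
      rw [← abs_mul]
      congr 1
      field_simp
    rw [e2, e1, jointProb_zero_sub_one, abs_mul, abs_of_nonneg hP]

/-- The bound `B` must hold for a single `z` and the sum over all runs together, since `v` is summed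
inside the supremum; the two values of `s` cancel the factor `1/2`. -/
lemma accProb_mul_compDist_le [Nonempty Z] (z₀ : Z) (B : Bits (2 * 2 ^ m) → E → ℝ)
    (hB : ∀ u e z, ∑ v, S.prob (Fin.append u v) e *
      ∑ w, |D.corr (selectedRun v) w (aliceSetting u) (bobSetting u) z| ≤ B u e) :
    accProb D S z₀ * compDist D S ≤ ∑ u, ∑ e, B u e := by
  have key : ∀ s u e, accProb D S z₀ * (⨆ z, ∑ v, ∑ w, deviation D S s u v e w z) ≤
      1 / 2 * B u e := by
    intro s u e
    rw [Real.mul_iSup_of_nonneg (accProb_nonneg D S z₀)]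
    refine ciSup_le fun z => ?_
    refine le_trans ?_ (mul_le_mul_of_nonneg_left (hB u e z) (by norm_num))
    simp only [Finset.mul_sum]
    exact Finset.sum_le_sum fun v _ => Finset.sum_le_sum fun w _ =>
      accProb_mul_deviation_le D S s u v e w z z₀
  calc accProb D S z₀ * compDist D S ≤ ∑ _s : Fin 2, ∑ u, ∑ e, 1 / 2 * B u e := by
        simp only [compDist, Finset.mul_sum (a := accProb D S z₀)]
        exact Finset.sum_le_sum fun s _ => Finset.sum_le_sum fun u _ =>
          Finset.sum_le_sum fun e _ => key s u e
    _ = ∑ u, ∑ e, B u e := by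
        simp only [← Finset.mul_sum, Fin.sum_univ_two]
        ring

/-- Here `z` may vary with the selected run, so each run needs its own bound. -/
lemma accProb_mul_compDistLate_le [Nonempty Z] (z₀ : Z) (B : Bits (2 * 2 ^ m) → Bits m → ℝ)
    (hB : ∀ u v z, ∑ w, |D.corr (selectedRun v) w (aliceSetting u) (bobSetting u) z| ≤ B u v) :
    accProb D S z₀ * compDistLate D S ≤
      ∑ u, ∑ v, ∑ e, S.prob (Fin.append u v) e * B u v := by
  have key : ∀ s u v e, accProb D S z₀ * (⨆ z, ∑ w, deviation D S s u v e w z) ≤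
      1 / 2 * (S.prob (Fin.append u v) e * B u v) := by
    intro s u v e
    rw [Real.mul_iSup_of_nonneg (accProb_nonneg D S z₀)]
    refine ciSup_le fun z => ?_
    refine le_trans ?_ (mul_le_mul_of_nonneg_left
      (mul_le_mul_of_nonneg_left (hB u v z) (S.nonneg _ _)) (by norm_num))
    simp only [Finset.mul_sum]
    exact Finset.sum_le_sum fun w _ => accProb_mul_deviation_le D S s u v e w z z₀
  calc accProb D S z₀ * compDistLate D S
      ≤ ∑ _s : Fin 2, ∑ u, ∑ v, ∑ e, 1 / 2 * (S.prob (Fin.append u v) e * B u v) := by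
        simp only [compDistLate, Finset.mul_sum (a := accProb D S z₀)]
        exact Finset.sum_le_sum fun s _ => Finset.sum_le_sum fun u _ =>
          Finset.sum_le_sum fun v _ => Finset.sum_le_sum fun e _ => key s u v e
    _ = _ := by
        simp only [← Finset.mul_sum, Fin.sum_univ_two]
        ring

lemma compDistLate_nonneg : 0 ≤ compDistLate D S :=
  Finset.sum_nonneg fun _ _ => Finset.sum_nonneg fun _ _ => Finset.sum_nonneg fun _ _ =>
    Finset.sum_nonneg fun _ _ => Real.iSup_nonneg fun _ => Finset.sum_nonneg fun _ _ =>
      abs_nonneg _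

/-- The probability to fail the test of run `r` for the settings `(0, 0)` and `(1, 0)`, the other
settings being given. -/
def Device.resetFail {M : ℕ} (D : Device M W Z) (r : Fin M) (u : Bits (2 * M)) (z : Z) : ℝ :=
  ∑ s, D.failProb r (Function.update (aliceSetting u) r s) (Function.update (bobSetting u) r 0) z

lemma Device.resetFail_nonneg {M : ℕ} (D : Device M W Z) (r : Fin M) (u : Bits (2 * M)) (z : Z) :
    0 ≤ D.resetFail r u z :=
  Finset.sum_nonneg fun _ _ => D.failProb_nonneg _ _ _ _

/-- Each reset pair `(s, 0)` costs a factor `(1/2 - ε)^(-2)`, and there are two of them. With the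
actual settings the first-failure probabilities telescope to the rejection probability. -/
lemma sum_resetFail_le (hε : ε < 1 / 2) (z : Z) :
    ∑ r, ∑ u, ∑ v, ∑ e, S.prob (Fin.append u v) e * D.resetFail r u z ≤
      2 / (1 / 2 - ε) ^ 2 * (1 - accProb D S z) := by
  have hδ : 0 < 1 / 2 - ε := by linarith
  have swap : ∀ f : Bits (2 * 2 ^ m) → ℝ, ∑ u, ∑ v, ∑ e, S.prob (Fin.append u v) e * f u =
      ∑ e, ∑ u, ∑ v, S.prob (Fin.append u v) e * f u := fun f => by
    rw [Finset.sum_comm (γ := E)]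
    exact Finset.sum_congr rfl fun u _ => Finset.sum_comm
  have hr : ∀ r : Fin (2 ^ m), ∑ u, ∑ v, ∑ e, S.prob (Fin.append u v) e * D.resetFail r u z ≤
      2 / (1 / 2 - ε) ^ 2 * ∑ u, ∑ v, ∑ e, S.prob (Fin.append u v) e *
        D.failProb r (aliceSetting u) (bobSetting u) z := by
    intro r
    rw [swap (fun u => D.resetFail r u z),
      swap (fun u => D.failProb r (aliceSetting u) (bobSetting u) z), Finset.mul_sum]
    refine Finset.sum_le_sum fun e _ => ?_
    have hs : ∀ s : Fin 2, ∑ u, ∑ v, S.prob (Fin.append u v) e *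
        D.failProb r (Function.update (aliceSetting u) r s)
          (Function.update (bobSetting u) r 0) z ≤
        1 / (1 / 2 - ε) ^ 2 * ∑ u, ∑ v, S.prob (Fin.append u v) e *
          D.failProb r (aliceSetting u) (bobSetting u) z := fun s => by
      rw [one_div, inv_mul_eq_div, le_div_iff₀' (by positivity)]
      exact sum_update_settings_le hε.le S r s 0 e (fun x y => D.failProb r x y z)
        (fun x y => D.failProb_nonneg _ _ _ _) fun x x' y y' hx hy => D.failProb_congr z hx hy
    calc ∑ u, ∑ v, S.prob (Fin.append u v) e * D.resetFail r u z
        = ∑ s : Fin 2, ∑ u, ∑ v, S.prob (Fin.append u v) e *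
            D.failProb r (Function.update (aliceSetting u) r s)
              (Function.update (bobSetting u) r 0) z := by
          simp only [Device.resetFail, Finset.mul_sum]
          rw [Finset.sum_comm (s := (Finset.univ : Finset (Fin 2)))]
          refine Finset.sum_congr rfl fun u _ => ?_
          rw [Finset.sum_comm]
      _ ≤ _ := by
          refine (Finset.sum_le_sum fun s _ => hs s).trans (le_of_eq ?_)
          rw [Fin.sum_univ_two]
          ring
  refine (Finset.sum_le_sum fun r _ => hr r).trans (le_of_eq ?_)
  rw [← Finset.mul_sum, one_sub_accProb]
  congr 1
  rw [Finset.sum_comm]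
  refine Finset.sum_congr rfl fun u _ => ?_
  rw [Finset.sum_comm]
  refine Finset.sum_congr rfl fun v _ => ?_
  rw [Finset.sum_comm]
  refine Finset.sum_congr rfl fun e _ => ?_
  rw [← Finset.mul_sum, Device.sum_failProb]

lemma sum_selectedRun {V : Type*} [AddCommMonoid V] (f : Fin (2 ^ m) → V) :
    ∑ v : Bits m, f (selectedRun v) = ∑ r, f r :=
  Equiv.sum_comp finFunctionFinEquiv f

/-- The mean drift in the selected run. -/
lemma sum_prob_mul_sqrt_resetFail_le (hε₀ : 0 ≤ ε) (hε : ε < 1 / 2) (z : Z) :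
    ∑ u, ∑ v, ∑ e, S.prob (Fin.append u v) e * √(D.resetFail (selectedRun v) u z) ≤
      √((1 / 2 + ε) ^ m) * (2 / (1 / 2 - ε) * √(1 - accProb D S z)) := by
  have hδ : 0 < 1 / 2 - ε := by linarith
  have hacc := sub_nonneg.2 (accProb_le_one D S z)
  have hF := fun r u => D.resetFail_nonneg (M := 2 ^ m) r u z
  set I := Bits (2 * 2 ^ m) × Bits m × E
  have toI : ∀ f : Bits (2 * 2 ^ m) → Bits m → E → ℝ,
      ∑ u, ∑ v, ∑ e, f u v e = ∑ i : I, f i.1 i.2.1 i.2.2 := fun f => by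
    simp only [I, Fintype.sum_prod_type]
  -- Written as `√(p · (p f))`, the mean of `√f` is bounded by Cauchy–Schwarz, and the factor `∑ p`
  -- is `1`.
  have e1 : ∀ i : I, S.prob (Fin.append i.1 i.2.1) i.2.2 *
      √(D.resetFail (selectedRun i.2.1) i.1 z) =
      √(S.prob (Fin.append i.1 i.2.1) i.2.2 *
        (S.prob (Fin.append i.1 i.2.1) i.2.2 * D.resetFail (selectedRun i.2.1) i.1 z)) :=
    fun i => by
      rw [← mul_assoc, Real.sqrt_mul (mul_nonneg (S.nonneg _ _) (S.nonneg _ _)),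
        Real.sqrt_mul_self (S.nonneg _ _)]
  have h2 : ∑ u, ∑ v, ∑ e, S.prob (Fin.append u v) e * D.resetFail (selectedRun v) u z ≤
      (1 / 2 + ε) ^ m * (2 / (1 / 2 - ε) ^ 2 * (1 - accProb D S z)) := by
    refine le_trans ?_ (mul_le_mul_of_nonneg_left (sum_resetFail_le D S hε z) (by positivity))
    calc ∑ u, ∑ v, ∑ e, S.prob (Fin.append u v) e * D.resetFail (selectedRun v) u z
        -- The selection may be correlated with the settings; its conditional weight is replaced by
        -- the uniform upper bound `(1/2 + ε)^m`, so that all runs are summed with equal weight.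
        ≤ ∑ u, ∑ v, ∑ e, ((1 / 2 + ε) ^ m * ∑ v', S.prob (Fin.append u v') e) *
            D.resetFail (selectedRun v) u z :=
          Finset.sum_le_sum fun u _ => Finset.sum_le_sum fun v _ => Finset.sum_le_sum fun e _ =>
            mul_le_mul_of_nonneg_right (S.prob_append_le (by linarith) u v e) (hF _ _)
      _ = ∑ u, ∑ r, ∑ e, ((1 / 2 + ε) ^ m * ∑ v', S.prob (Fin.append u v') e) *
            D.resetFail r u z :=
          Finset.sum_congr rfl fun u _ => sum_selectedRun fun r =>
            ∑ e, ((1 / 2 + ε) ^ m * ∑ v', S.prob (Fin.append u v') e) * D.resetFail r u z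
      _ = _ := by
          rw [Finset.sum_comm, Finset.mul_sum]
          refine Finset.sum_congr rfl fun r _ => ?_
          rw [Finset.mul_sum]
          refine Finset.sum_congr rfl fun u _ => ?_
          rw [Finset.sum_comm (α := E), Finset.mul_sum]
          refine Finset.sum_congr rfl fun e _ => ?_
          rw [mul_assoc, Finset.sum_mul]
  calc ∑ u, ∑ v, ∑ e, S.prob (Fin.append u v) e * √(D.resetFail (selectedRun v) u z)
      ≤ √((∑ i : I, S.prob (Fin.append i.1 i.2.1) i.2.2) * ∑ i : I,
          S.prob (Fin.append i.1 i.2.1) i.2.2 * D.resetFail (selectedRun i.2.1) i.1 z) := by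
        rw [toI, Finset.sum_congr rfl fun i _ => e1 i]
        exact sum_sqrt_mul_le _ _ _ (fun i _ => S.nonneg _ _)
          fun i _ => mul_nonneg (S.nonneg _ _) (hF _ _)
    _ ≤ √((1 / 2 + ε) ^ m * (2 / (1 / 2 - ε) ^ 2 * (1 - accProb D S z))) := by
        rw [← toI fun u v e => S.prob (Fin.append u v) e, S.sum_prob_append, one_mul,
          ← toI fun u v e => S.prob (Fin.append u v) e * D.resetFail (selectedRun v) u z]
        exact Real.sqrt_le_sqrt h2
    -- The constant `2` is enlarged to `4` to give a perfect square.
    _ ≤ √((1 / 2 + ε) ^ m * ((2 / (1 / 2 - ε)) ^ 2 * (1 - accProb D S z))) := by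
        refine Real.sqrt_le_sqrt (mul_le_mul_of_nonneg_left (mul_le_mul_of_nonneg_right ?_ hacc)
          (by positivity))
        rw [div_pow]
        gcongr
        norm_num
    _ = _ := by
        rw [Real.sqrt_mul (by positivity), Real.sqrt_mul (by positivity),
          Real.sqrt_sq (by positivity)]

/-- The bound for an adversary who knows the selected run. -/
lemma accProb_mul_compDistLate_le_sqrt (hε₀ : 0 ≤ ε) (hε : ε < 1 / 2) (z : Z) :
    accProb D S z * compDistLate D S ≤ (1 - accProb D S z) +
      8 / (1 / 2 - ε) * √((1 / 2 + ε) ^ m) * √(1 - accProb D S z) := by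
  have : Nonempty Z := ⟨z⟩
  refine (accProb_mul_compDistLate_le D S z
    (fun u v => 4 * √(D.resetFail (selectedRun v) u z) +
      (1 - D.acceptProb (aliceSetting u) (bobSetting u) z)) fun u v z' => ?_).trans ?_
  · refine (D.sum_abs_corr_le _ _ _ _).trans ?_
    rw [D.acceptProb_eve _ _ z' z]
    refine add_le_add_left ((D.sum_drift_le _ _ _ _).trans (le_of_eq ?_)) _
    rw [Device.resetFail]
    simp only [D.failProb_eve _ _ _ z' z]
  · simp only [mul_add, Finset.sum_add_distrib, ← one_sub_accProb]
    rw [add_comm]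
    refine add_le_add_right ?_ _
    have h := mul_le_mul_of_nonneg_left (sum_prob_mul_sqrt_resetFail_le D S hε₀ hε z)
      (show (0 : ℝ) ≤ 4 by norm_num)
    simp only [Finset.mul_sum] at h
    refine le_trans (le_of_eq ?_) (h.trans (le_of_eq ?_))
    · exact Finset.sum_congr rfl fun u _ => Finset.sum_congr rfl fun v _ =>
        Finset.sum_congr rfl fun e _ => by ring
    · ring

/-- The bound for an adversary who chooses her input before the run is selected. -/
lemma accProb_mul_compDist_le_sqrt (hε₀ : 0 ≤ ε) (hε : ε < 1 / 2) (z : Z) :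
    accProb D S z * compDist D S ≤ (2 + 8 / (1 / 2 - ε)) * √((1 / 2 + ε) ^ m) := by
  have : Nonempty Z := ⟨z⟩
  have hδ : 0 < 1 / 2 - ε := by linarith
  refine (accProb_mul_compDist_le D S z
    (fun u e => 2 * (√((1 / 2 + ε) ^ m) * ∑ v, S.prob (Fin.append u v) e) +
      ∑ v, S.prob (Fin.append u v) e * (4 * √(D.resetFail (selectedRun v) u z)))
    fun u e z' => ?_).trans ?_
  -- The Bessel weights are the source probabilities of selecting each run for fixed `u, e`. Their
  -- squares sum to at most the largest weight times the total, that is, `(1/2 + ε)^m` times the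
  -- squared total.
  · set t : Fin (2 ^ m) → ℝ := fun r => S.prob (Fin.append u (finFunctionFinEquiv.symm r)) e with ht
    have ht0 : ∀ r, 0 ≤ t r := fun r => S.nonneg _ _
    have htv : ∀ v, t (selectedRun v) = S.prob (Fin.append u v) e := fun v => by
      simp [ht, selectedRun]
    have h := D.sum_mul_abs_corr_le t ht0 (aliceSetting u) (bobSetting u) z'
    rw [← sum_selectedRun, ← sum_selectedRun, ← sum_selectedRun] at h
    simp only [htv] at h
    refine h.trans (add_le_add ?_ ?_)
    · refine mul_le_mul_of_nonneg_left ?_ (by norm_num)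
      have hs : 0 ≤ ∑ v, S.prob (Fin.append u v) e := Finset.sum_nonneg fun v _ => S.nonneg _ _
      rw [← Real.sqrt_sq hs, ← Real.sqrt_mul (by positivity)]
      refine Real.sqrt_le_sqrt ?_
      rw [sq (∑ v, S.prob (Fin.append u v) e), ← mul_assoc, Finset.mul_sum]
      refine Finset.sum_le_sum fun v _ => ?_
      rw [sq]
      exact mul_le_mul_of_nonneg_right (S.prob_append_le (by linarith) u v e) (S.nonneg _ _)
    · refine Finset.sum_le_sum fun v _ => mul_le_mul_of_nonneg_left ?_ (S.nonneg _ _)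
      refine (D.sum_drift_le _ _ _ _).trans (le_of_eq ?_)
      rw [Device.resetFail]
      simp only [D.failProb_eve _ _ _ z' z]
  · have h1 : ∑ u, ∑ e, 2 * (√((1 / 2 + ε) ^ m) * ∑ v, S.prob (Fin.append u v) e) =
        2 * √((1 / 2 + ε) ^ m) := by
      simp only [← Finset.mul_sum]
      have : ∑ u, ∑ e, ∑ v, S.prob (Fin.append u v) e = 1 := by
        rw [← S.sum_prob_append]
        exact Finset.sum_congr rfl fun u _ => Finset.sum_comm
      rw [this, mul_one]
    have h2 : ∑ u, ∑ e, ∑ v, S.prob (Fin.append u v) e *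
        (4 * √(D.resetFail (selectedRun v) u z)) =
        4 * ∑ u, ∑ v, ∑ e, S.prob (Fin.append u v) e * √(D.resetFail (selectedRun v) u z) := by
      rw [Finset.mul_sum]
      refine Finset.sum_congr rfl fun u _ => ?_
      rw [Finset.sum_comm, Finset.mul_sum]
      refine Finset.sum_congr rfl fun v _ => ?_
      rw [Finset.mul_sum]
      exact Finset.sum_congr rfl fun e _ => by ring
    simp only [Finset.sum_add_distrib]
    rw [h1, h2]
    have h3 := sum_prob_mul_sqrt_resetFail_le D S hε₀ hε z
    have h4 : √(1 - accProb D S z) ≤ 1 := by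
      rw [Real.sqrt_le_one]
      linarith [accProb_nonneg D S z]
    have h5 : √((1 / 2 + ε) ^ m) * (2 / (1 / 2 - ε) * √(1 - accProb D S z)) ≤
        √((1 / 2 + ε) ^ m) * (2 / (1 / 2 - ε) * 1) := by gcongr
    have h6 : (2 + 8 / (1 / 2 - ε)) * √((1 / 2 + ε) ^ m) = 2 * √((1 / 2 + ε) ^ m) +
        4 * (√((1 / 2 + ε) ^ m) * (2 / (1 / 2 - ε) * 1)) := by ring
    rw [h6]
    linarith

end Protocol

/-! ### Sequential quantum models are devices -/

section SeqProd

variable {ι : Type*} [Fintype ι] [DecidableEq ι]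

/-- The product, in temporal order, of the operators of one party. -/
def seqProd {n : ℕ} (K : Fin n → Fin 2 → Fin 2 → Matrix ι ι ℂ) (a x : Bits n) : Matrix ι ι ℂ :=
  (List.ofFn fun k => K k (a k) (x k)).prod

lemma seqProd_cons {n : ℕ} (K : Fin (n + 1) → Fin 2 → Fin 2 → Matrix ι ι ℂ) (c : Fin 2)
    (a : Bits n) (x : Bits (n + 1)) :
    seqProd K (Fin.cons c a : Bits (n + 1)) x =
      K 0 c (x 0) * seqProd (fun k => K k.succ) a (fun k => x k.succ) := by
  simp [seqProd, List.ofFn_succ]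

lemma sum_bits_succ {n : ℕ} {V : Type*} [AddCommMonoid V] (f : Bits (n + 1) → V) :
    ∑ a, f a = ∑ c, ∑ a : Bits n, f (Fin.cons c a : Bits (n + 1)) := by
  rw [← (Fin.consEquiv fun _ : Fin (n + 1) => Fin 2).sum_comp, Fintype.sum_prod_type]
  rfl

/-- The last run sits innermost in `V V†`, so the completeness relations collapse the product from
the inside out. -/
lemma sum_seqProd_mul_conjTranspose {n : ℕ} (K : Fin n → Fin 2 → Fin 2 → Matrix ι ι ℂ)
    (hK : ∀ k x, ∑ a, K k a x * (K k a x).conjTranspose = 1) (x : Bits n) :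
    ∑ a, seqProd K a x * (seqProd K a x).conjTranspose = 1 := by
  induction n with
  | zero => simp [seqProd]
  | succ n ih =>
    rw [sum_bits_succ]
    simp only [seqProd_cons, Matrix.conjTranspose_mul]
    have : ∀ c, ∑ a : Bits n, K 0 c (x 0) * seqProd (fun k => K k.succ) a (fun k => x k.succ) *
        ((seqProd (fun k => K k.succ) a fun k => x k.succ).conjTranspose *
          (K 0 c (x 0)).conjTranspose) = K 0 c (x 0) * (K 0 c (x 0)).conjTranspose := fun c => by
      have h := ih (fun k => K k.succ) (fun k => hK k.succ) fun k => x k.succ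
      calc _ = K 0 c (x 0) * (∑ a : Bits n, seqProd (fun k => K k.succ) a (fun k => x k.succ) *
            (seqProd (fun k => K k.succ) a fun k => x k.succ).conjTranspose) *
              (K 0 c (x 0)).conjTranspose := by
            rw [Finset.mul_sum, Finset.sum_mul]
            exact Finset.sum_congr rfl fun a _ => by simp only [Matrix.mul_assoc]
        _ = _ := by rw [h, mul_one]
    rw [Finset.sum_congr rfl fun c _ => this c, hK]

lemma agreeBelow_cons_iff {n k : ℕ} {c : Fin 2} {a : Bits n} {s : Bits (n + 1)} :
    AgreeBelow (k + 1) (Fin.cons c a : Bits (n + 1)) s ↔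
      c = s 0 ∧ AgreeBelow k a fun i => s i.succ := by
  constructor
  · intro h
    exact ⟨h 0 (Nat.succ_pos k), fun i hi => by
      simpa using h i.succ (by simpa using hi)⟩
  · rintro ⟨h0, h⟩ i
    refine Fin.cases (fun _ => by simpa using h0) (fun j hj => ?_) i
    simpa using h j (by simpa using hj)

open Classical in
/-- Summing over the later outcomes removes the dependence on the later settings. -/
lemma sum_class_seqProd {n : ℕ} (K : Fin n → Fin 2 → Fin 2 → Matrix ι ι ℂ)
    (hK : ∀ k x, ∑ a, K k a x * (K k a x).conjTranspose = 1) (k : ℕ) (a₀ x x' : Bits n)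
    (hx : AgreeBelow k x x') :
    ∑ a with AgreeBelow k a a₀, seqProd K a x * (seqProd K a x).conjTranspose =
      ∑ a with AgreeBelow k a a₀, seqProd K a x' * (seqProd K a x').conjTranspose := by
  induction n generalizing k with
  | zero => rw [Subsingleton.elim x x']
  | succ n ih =>
    cases k with
    | zero =>
      have h : (Finset.univ.filter fun a => AgreeBelow 0 a a₀) = Finset.univ :=
        Finset.filter_true_of_mem fun a _ i hi => absurd hi (Nat.not_lt_zero _)
      rw [h, sum_seqProd_mul_conjTranspose K hK, sum_seqProd_mul_conjTranspose K hK]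
    | succ k =>
      have e : ∀ x : Bits (n + 1), ∑ a with AgreeBelow (k + 1) a a₀,
          seqProd K a x * (seqProd K a x).conjTranspose = K 0 (a₀ 0) (x 0) *
            (∑ a with AgreeBelow k a fun i => a₀ i.succ,
              seqProd (fun k => K k.succ) a (fun k => x k.succ) *
              (seqProd (fun k => K k.succ) a fun k => x k.succ).conjTranspose) *
            (K 0 (a₀ 0) (x 0)).conjTranspose := by
        intro x
        rw [Finset.sum_filter, sum_bits_succ, Finset.sum_eq_single (a₀ 0)]
        · rw [Finset.mul_sum, Finset.sum_mul, Finset.sum_filter]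
          refine Finset.sum_congr rfl fun a _ => ?_
          simp only [agreeBelow_cons_iff, true_and, seqProd_cons, Matrix.conjTranspose_mul,
            Matrix.mul_assoc]
        · intro c _ hc
          exact Finset.sum_eq_zero fun a _ => if_neg fun h => hc (agreeBelow_cons_iff.1 h).1
        · exact fun h => absurd (Finset.mem_univ _) h
      rw [e, e, hx 0 (Nat.succ_pos k),
        ih (fun k => K k.succ) (fun k => hK k.succ) k (fun i => a₀ i.succ) (fun i => x i.succ)
          (fun i => x' i.succ) fun i hi => hx i.succ (by simpa using hi)]

end SeqProd

/-! ### Kronecker products and partial traces -/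

section Kronecker

variable {α β γ : Type*}

lemma sum_kronecker {κ : Type*} (s : Finset κ) (A : κ → Matrix α α ℂ) (B : Matrix β β ℂ) :
    (∑ i ∈ s, A i) ⊗ₖ B = ∑ i ∈ s, A i ⊗ₖ B := by
  ext ⟨i, j⟩ ⟨i', j'⟩
  simp [Matrix.sum_apply, Finset.sum_mul]

lemma kronecker_sum {κ : Type*} (s : Finset κ) (A : Matrix α α ℂ) (B : κ → Matrix β β ℂ) :
    A ⊗ₖ (∑ i ∈ s, B i) = ∑ i ∈ s, A ⊗ₖ B i := by
  ext ⟨i, j⟩ ⟨i', j'⟩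
  simp [Matrix.sum_apply, Finset.mul_sum]

variable [Fintype α] [Fintype β] [Fintype γ] [DecidableEq α] [DecidableEq β] [DecidableEq γ]

lemma prod_ofFn_kronecker {n : ℕ} (A : Fin n → Matrix α α ℂ) (B : Fin n → Matrix β β ℂ) :
    (List.ofFn fun k => A k ⊗ₖ (B k ⊗ₖ (1 : Matrix γ γ ℂ))).prod =
      (List.ofFn A).prod ⊗ₖ ((List.ofFn B).prod ⊗ₖ 1) := by
  induction n with
  | zero => simp
  | succ n ih =>
    simp only [List.ofFn_succ, List.prod_cons, ih, ← Matrix.mul_kronecker_mul, one_mul]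

/-- The matrix elements of a partial trace. -/
lemma sum_diag_eq_trace (X : Matrix (α × (β × γ)) (α × (β × γ)) ℂ) (u v : γ) :
    ∑ p, ∑ q, X (p, (q, u)) (p, (q, v)) =
      (X * ((1 : Matrix α α ℂ) ⊗ₖ ((1 : Matrix β β ℂ) ⊗ₖ Matrix.single v u 1))).trace := by
  simp only [Matrix.trace, Matrix.diag_apply, Matrix.mul_apply, Fintype.sum_prod_type,
    Matrix.kroneckerMap_apply, Matrix.one_apply, Matrix.single_apply]
  simp [Finset.sum_ite_eq, ite_and]

end Kronecker

namespace SeqQuantumModel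

variable {M : ℕ} (Q : SeqQuantumModel M)

lemma kraus_eq (a b x y : Bits M) :
    Q.kraus a b x y = seqProd Q.K a x ⊗ₖ (seqProd Q.L b y ⊗ₖ (1 : QubitOp M)) :=
  prod_ofFn_kronecker _ _

/-- By cyclicity the model depends on Alice and Bob only through `K K†` and `L L†`, whose partial
sums are controlled by completeness. The matrix unit reads off one entry of Charlie's operator. -/
lemma family_apply (a b x y u v : Bits M) : Q.family a b x y u v =
    (Q.rho * ((seqProd Q.K a x * (seqProd Q.K a x).conjTranspose) ⊗ₖ
      ((seqProd Q.L b y * (seqProd Q.L b y).conjTranspose) ⊗ₖ Matrix.single v u 1))).trace := by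
  rw [family, Matrix.of_apply, sum_diag_eq_trace, Matrix.mul_assoc, Matrix.mul_assoc,
    Matrix.trace_mul_comm, Matrix.mul_assoc, Matrix.mul_assoc, kraus_eq,
    Matrix.conjTranspose_kronecker, Matrix.conjTranspose_kronecker, ← Matrix.mul_kronecker_mul,
    ← Matrix.mul_kronecker_mul, ← Matrix.mul_kronecker_mul, ← Matrix.mul_kronecker_mul,
    Matrix.conjTranspose_one, one_mul, one_mul, one_mul, mul_one]

lemma family_posSemidef (a b x y : Bits M) : (Q.family a b x y).PosSemidef := by
  have h : Q.family a b x y = ∑ p, ∑ q,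
      ((Q.kraus a b x y).conjTranspose * Q.rho * Q.kraus a b x y).submatrix
        (fun u => (p, (q, u))) fun u => (p, (q, u)) := by
    ext u v
    simp [family, Matrix.sum_apply]
  rw [h]
  exact Matrix.posSemidef_sum _ fun p _ => Matrix.posSemidef_sum _ fun q _ =>
    (Q.rho_pos.conjTranspose_mul_mul_same _).submatrix _

lemma sum_trace_family (x y : Bits M) : ∑ a, ∑ b, (Q.family a b x y).trace = 1 := by
  have h : ∀ u, ∑ a, ∑ b, Q.family a b x y u u = ∑ p, ∑ q, Q.rho (p, (q, u)) (p, (q, u)) := by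
    intro u
    simp only [family_apply, sum_diag_eq_trace]
    simp only [← Matrix.trace_sum, ← Matrix.mul_sum, ← kronecker_sum, ← sum_kronecker,
      sum_seqProd_mul_conjTranspose _ Q.K_complete, sum_seqProd_mul_conjTranspose _ Q.L_complete]
  calc ∑ a, ∑ b, (Q.family a b x y).trace = ∑ u, ∑ a, ∑ b, Q.family a b x y u u := by
        simp only [Matrix.trace, Matrix.diag_apply]
        rw [Finset.sum_comm (f := fun u a => ∑ b, Q.family a b x y u u)]
        exact Finset.sum_congr rfl fun a _ => Finset.sum_comm
    _ = Q.rho.trace := by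
        simp only [h, Matrix.trace, Matrix.diag_apply, Fintype.sum_prod_type]
        rw [Finset.sum_comm]
        exact Finset.sum_congr rfl fun a _ => Finset.sum_comm
    _ = 1 := Q.rho_trace

/-- A sequential quantum model as a device with a trivial adversary. -/
def toDevice : Device M Unit Unit where
  op a b _ x y _ := Q.family a b x y
  pos a b _ x y _ := Q.family_posSemidef a b x y
  norm x y _ := by simpa using Q.sum_trace_family x y
  alice k a b _ x x' y _ h := by
    classical
    ext u v
    simp only [Matrix.sum_apply, family_apply, ← Matrix.trace_sum, ← Matrix.mul_sum,
      ← sum_kronecker]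
    rw [sum_class_seqProd Q.K Q.K_complete k a x x' h]
  bob k a b _ x y y' _ h := by
    classical
    ext u v
    simp only [Matrix.sum_apply, family_apply, ← Matrix.trace_sum, ← Matrix.mul_sum,
      ← kronecker_sum, ← sum_kronecker]
    rw [sum_class_seqProd Q.L Q.L_complete k b y y' h]
  eve _ _ _ _ _ _ := rfl

lemma toDevice_hasHonestPart : Q.toDevice.HasHonestPart Q.family := fun a b x y z => by
  simp [toDevice]

end SeqQuantumModel

/-! ### The GHZ assemblage is quantum -/

lemma pauliProj_mul_conjTranspose (a x : Fin 2) :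
    pauliProj a x * (pauliProj a x).conjTranspose = pauliProj a x := by
  ext u v
  fin_cases a <;> fin_cases x <;> fin_cases u <;> fin_cases v <;>
    norm_num [pauliProj, Matrix.mul_apply, Fin.sum_univ_two, Matrix.conjTranspose_apply,
      map_ofNat]

lemma sum_pauliProj (x : Fin 2) : ∑ a, pauliProj a x = 1 := by
  ext u v
  fin_cases x <;> fin_cases u <;> fin_cases v <;> norm_num [pauliProj, Fin.sum_univ_two]

section Local

variable {M : ℕ}

/-- The operator `A` on the factor `k`. -/
def localOp (k : Fin M) (A : Matrix (Fin 2) (Fin 2) ℂ) : QubitOp M :=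
  tensorOp (Function.update (fun _ => 1) k A)

lemma localOp_mul_conjTranspose (k : Fin M) (A : Matrix (Fin 2) (Fin 2) ℂ) :
    localOp k A * (localOp k A).conjTranspose = localOp k (A * A.conjTranspose) := by
  rw [localOp, conjTranspose_tensorOp, tensorOp_mul, localOp]
  congr 1
  funext i
  by_cases h : i = k
  · subst h; simp
  · simp [Function.update_of_ne h]

lemma localOp_complete (k : Fin M) (x : Fin 2) :
    ∑ a, localOp k (pauliProj a x) * (localOp k (pauliProj a x)).conjTranspose = 1 := by
  simp only [localOp_mul_conjTranspose, pauliProj_mul_conjTranspose]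
  have h : ∀ a, localOp k (pauliProj a x) = tensorOpAt (fun _ => 1) k (pauliProj a x) :=
    fun a => rfl
  simp only [h]
  rw [← map_sum, sum_pauliProj]
  change tensorOp (Function.update (fun _ => 1) k 1) = 1
  rw [Function.update_eq_self_iff.2 rfl, tensorOp_one]

lemma actsUpTo_localOp (k : Fin M) (A : Matrix (Fin 2) (Fin 2) ℂ) :
    ActsUpTo (d := fun _ => 2) k (localOp k A) := by
  classical
  refine ⟨Matrix.of fun u v => ∏ i : {i // i ≤ k},
    (Function.update (fun _ => (1 : Matrix (Fin 2) (Fin 2) ℂ)) k A) i.1 (u i) (v i),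
    fun u v => ?_⟩
  have h : localOp k A u v = (∏ i : {i // i ≤ k},
      (Function.update (fun _ => (1 : Matrix (Fin 2) (Fin 2) ℂ)) k A) i.1 (u i) (v i)) *
      ∏ i : {i // ¬ i ≤ k}, (1 : Matrix (Fin 2) (Fin 2) ℂ) (u i) (v i) := by
    rw [localOp, tensorOp, Matrix.of_apply,
      ← Fintype.prod_subtype_mul_prod_subtype (fun i => i ≤ k)]
    congr 1
    refine Finset.prod_congr rfl fun i _ => ?_
    rw [Function.update_of_ne fun h => i.2 h.le]
  rw [h]
  split_ifs with hi
  · rw [Finset.prod_eq_one (s := Finset.univ) (f := fun i : {i // ¬ i ≤ k} =>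
      (1 : Matrix (Fin 2) (Fin 2) ℂ) (u i) (v i)), mul_one]
    · rfl
    · intro i _
      rw [hi i (not_le.1 i.2), Matrix.one_apply_eq]
  · push Not at hi
    obtain ⟨i, hk, hne⟩ := hi
    rw [Finset.prod_eq_zero (i := (⟨i, not_le.2 hk⟩ : {i // ¬ i ≤ k})) (Finset.mem_univ _),
      mul_zero]
    exact Matrix.one_apply_ne hne

/-- The product of the first `k` operators acts on the first `k` factors and as the identity
elsewhere. -/
lemma prod_ofFn_localOp (A : Fin M → Matrix (Fin 2) (Fin 2) ℂ) :
    (List.ofFn fun k => localOp k (A k)).prod = tensorOp A := by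
  have key : ∀ k, k ≤ M → ((List.ofFn fun k => localOp k (A k)).take k).prod =
      tensorOp fun i => if i.val < k then A i else 1 := by
    intro k
    induction k with
    | zero => intro _; simp [tensorOp_one]
    | succ k ih =>
      intro hk
      rw [List.prod_take_succ _ _ (by simpa using hk), ih (by omega), List.getElem_ofFn, localOp,
        tensorOp_mul]
      congr 1
      funext i
      by_cases h : i = ⟨k, hk⟩
      · subst h; simp
      · have : i.val ≠ k := fun h' => h (Fin.ext h')
        rw [Function.update_of_ne h, mul_one]
        have : i.val < k ↔ i.val < k + 1 := by omega
        simp only [this]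
  have := key M le_rfl
  rw [List.take_of_length_le (by simp)] at this
  rw [this]
  congr 1
  funext i
  rw [if_pos i.isLt]

end Local

/-- The amplitudes of the `M`-fold product of the GHZ state. -/
def ghzVecs (M : ℕ) (i : Bits M × (Bits M × Bits M)) : ℂ :=
  ∏ k, ghzVec (i.1 k) (i.2.1 k) (i.2.2 k)

lemma sum_ghzVec_mul_star :
    ∑ p, ∑ q, ∑ u, ghzVec p q u * star (ghzVec p q u) = 1 := by
  have h : ((√2 : ℝ) : ℂ)⁻¹ * ((√2 : ℝ) : ℂ)⁻¹ = 1 / 2 := by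
    rw [← mul_inv, ← Complex.ofReal_mul, Real.mul_self_sqrt (by norm_num)]
    norm_num
  simp [ghzVec, Fin.sum_univ_two, h]
  norm_num

/-- The quantum model of the product of GHZ states measured run by run. -/
def ghzModel (M : ℕ) : SeqQuantumModel M where
  dA _ := 2
  dB _ := 2
  rho := Matrix.vecMulVec (ghzVecs M) (star (ghzVecs M))
  rho_pos := Matrix.posSemidef_vecMulVec_self_star _
  rho_trace := by
    have h : ∏ _k : Fin M, ∑ p, ∑ q, ∑ u, ghzVec p q u * star (ghzVec p q u) = 1 := by
      simp only [sum_ghzVec_mul_star, Finset.prod_const_one]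
    rw [← h]
    simp only [Fintype.prod_sum, Matrix.trace, Matrix.diag_apply, Matrix.vecMulVec_apply,
      Fintype.sum_prod_type, ghzVecs, Pi.star_apply, star_prod, Finset.prod_mul_distrib]
  K k a x := localOp k (pauliProj a x)
  L k b y := localOp k (pauliProj b y)
  K_local k _ _ := actsUpTo_localOp k _
  L_local k _ _ := actsUpTo_localOp k _
  K_complete := localOp_complete
  L_complete := localOp_complete

/-- The Kraus operators are commuting local projectors, so `V V†` is a tensor product of projectors.
State and measurement factor over the runs, and sums of products over strings become products of
sums. -/
lemma ghzModel_family (M : ℕ) : (ghzModel M).family = ghzFamily M := by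
  funext a b x y
  ext u v
  have hP : ∀ a x : Bits M, (List.ofFn fun k => localOp k (pauliProj (a k) (x k))).prod *
      ((List.ofFn fun k => localOp k (pauliProj (a k) (x k))).prod).conjTranspose =
        tensorOp fun k => pauliProj (a k) (x k) := fun a x => by
    rw [prod_ofFn_localOp, conjTranspose_tensorOp, tensorOp_mul]
    simp only [pauliProj_mul_conjTranspose]
  have h := (ghzModel M).family_apply a b x y u v
  have hK : seqProd (ghzModel M).K a x * (seqProd (ghzModel M).K a x).conjTranspose =
      tensorOp fun k => pauliProj (a k) (x k) := hP a x
  have hL : seqProd (ghzModel M).L b y * (seqProd (ghzModel M).L b y).conjTranspose =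
      tensorOp fun k => pauliProj (b k) (y k) := hP b y
  rw [h, hK, hL]
  have tr : ∀ A B : QubitOp M, (Matrix.vecMulVec (ghzVecs M) (star (ghzVecs M)) *
      (A ⊗ₖ (B ⊗ₖ Matrix.single v u 1))).trace = ∑ p, ∑ p', ∑ q, ∑ q',
        A p p' * B q q' * ghzVecs M (p', (q', u)) * star (ghzVecs M (p, (q, v))) := by
    intro A B
    rw [Matrix.trace_mul_comm]
    simp only [Matrix.trace, Matrix.diag_apply, Matrix.mul_apply, Fintype.sum_prod_type,
      Matrix.kroneckerMap_apply, Matrix.single_apply, Matrix.vecMulVec_apply, Pi.star_apply,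
      ite_and, mul_ite, mul_one, mul_zero, ite_mul, zero_mul]
    refine Finset.sum_congr rfl fun p _ => ?_
    rw [Finset.sum_comm, Finset.sum_eq_single v, Finset.sum_comm]
    · refine Finset.sum_congr rfl fun p' _ => Finset.sum_congr rfl fun q _ =>
        Finset.sum_congr rfl fun q' _ => ?_
      simp [mul_assoc]
    · intro v' _ hv'
      simp [hv'.symm]
    · exact fun h => absurd (Finset.mem_univ v) h
  refine (tr _ _).trans ?_
  simp only [ghzFamily, tensorOp, Matrix.of_apply, ghzRun, Fintype.prod_sum, ghzVecs, star_prod,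
    Finset.prod_mul_distrib]

/-! ### The ideal behaviour -/

lemma sum_trace_ghzFamily (M : ℕ) (x y : Bits M) : ∑ a, ∑ b, (ghzFamily M a b x y).trace = 1 := by
  have h : ∏ k, ∑ a, ∑ b, (ghzRun a b (x k) (y k)).trace = 1 := by
    simp only [sum_trace_ghzRun, Finset.prod_const_one]
  rw [← h]
  simp only [Fintype.prod_sum, ghzFamily, trace_tensorOp]

/-- Each test projector fixes the GHZ operator it was built from, so testing leaves the total trace
at `1`. -/
lemma Device.acceptProb_of_hasHonestPart {M : ℕ} {W Z : Type} [Fintype W] {D : Device M W Z}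
    (hD : D.HasHonestPart (ghzFamily M)) (x y : Bits M) (z : Z) : D.acceptProb x y z = 1 := by
  have h : ∀ a b, ∑ w, D.passProb a b w x y z = (ghzFamily M a b x y).trace.re := fun a b => by
    simp only [passProb, ← Complex.re_sum, ← Matrix.trace_sum, ← Matrix.mul_sum, hD a b x y z]
    simp only [ghzFamily, tensorOp_mul, testProj_mul_ghzRun]
  have h2 : D.acceptProb x y z = ∑ a, ∑ b, ∑ w, D.passProb a b w x y z := by
    rw [acceptProb, Finset.sum_comm]
    exact Finset.sum_congr rfl fun a _ => Finset.sum_comm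
  rw [h2]
  simp only [h, ← Complex.re_sum, sum_trace_ghzFamily, Complex.one_re]

lemma accProb_of_hasHonestPart {ε : ℝ} {m : ℕ} {W Z E : Type} [Fintype W] [Fintype E]
    {D : Device (2 ^ m) W Z} (hD : D.HasHonestPart (ghzFamily (2 ^ m)))
    (S : SVSource ε (2 * 2 ^ m + m) E) (z : Z) : accProb D S z = 1 := by
  simp only [accProb_eq, Device.acceptProb_of_hasHonestPart hD, mul_one, S.sum_prob_append]

/-- The decay rate of the guessing probability of the selected run, as a power of the number of
runs. -/
lemma sqrt_pow_eq_rpow {c : ℝ} (hc : 0 < c) (m : ℕ) :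
    √(c ^ m) = ((2 : ℝ) ^ m) ^ (-(-Real.logb 2 c / 2)) := by
  rw [Real.sqrt_eq_rpow, ← Real.rpow_natCast, ← Real.rpow_natCast, ← Real.rpow_mul hc.le,
    ← Real.rpow_mul (by norm_num)]
  nth_rewrite 1 [← Real.rpow_logb (b := 2) (by norm_num) (by norm_num) hc]
  rw [← Real.rpow_mul (by norm_num)]
  congr 1
  ring

end

theorem theorem2 (ε : ℝ) (hε₀ : 0 ≤ ε) (hε : ε < 1 / 2) :
    ∃ C κ : ℝ, 0 < C ∧ 0 < κ ∧ ∀ m : ℕ,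
      -- the ideal behaviour is quantum, and quantum devices are among the devices considered
      IsSeqQuantum (ghzFamily (2 ^ m)) ∧
      (∀ τ : OpFamily (2 ^ m), IsSeqQuantum τ →
        ∃ D : Device (2 ^ m) Unit Unit, D.HasHonestPart τ) ∧
      ∀ (W Z E : Type) [Fintype W] [Fintype Z] [Fintype E]
        (D : Device (2 ^ m) W Z) (S : SVSource ε (2 * 2 ^ m + m) E) (z : Z),
        -- devices with the ideal behaviour are accepted and give a perfect bit
        (D.HasHonestPart (ghzFamily (2 ^ m)) → accProb D S z = 1 ∧ compDistLate D S = 0) ∧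
        -- arbitrary devices
        accProb D S z * compDist D S ≤ C * ((2 : ℝ) ^ m) ^ (-κ) ∧
        accProb D S z * compDistLate D S ≤
          (1 - accProb D S z) + C * ((2 : ℝ) ^ m) ^ (-κ) * Real.sqrt (1 - accProb D S z) := by
  have hδ : 0 < 1 / 2 - ε := by linarith
  have hc : 0 < 1 / 2 + ε := by linarith
  -- In `C`, the `2` comes from the Bessel inequality and `8 / (1/2 - ε)` is `4` from the single-run
  -- bias times `2 / (1/2 - ε)` from the mean drift. The exponent is half the min-entropy per bit
  -- guaranteed by the source, positive because `1/2 + ε < 1`.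
  refine ⟨2 + 8 / (1 / 2 - ε), -Real.logb 2 (1 / 2 + ε) / 2, by positivity, ?_, fun m => ?_⟩
  · have := Real.logb_neg (b := 2) (by norm_num) hc (by linarith)
    linarith
  rw [← sqrt_pow_eq_rpow hc]
  refine ⟨⟨ghzModel _, ghzModel_family _⟩, ?_, fun W Z E _ _ _ D S z => ⟨fun hD => ?_, ?_, ?_⟩⟩
  · rintro τ ⟨Q, rfl⟩
    exact ⟨Q.toDevice, Q.toDevice_hasHonestPart⟩
  · have h1 := accProb_of_hasHonestPart hD S z
    refine ⟨h1, le_antisymm ?_ (compDistLate_nonneg D S)⟩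
    -- Both terms of the bound carry a power of `1 - p_acc = 0`.
    simpa [h1] using accProb_mul_compDistLate_le_sqrt D S hε₀ hε z
  · exact accProb_mul_compDist_le_sqrt D S hε₀ hε z
  · refine (accProb_mul_compDistLate_le_sqrt D S hε₀ hε z).trans (add_le_add_right ?_ _)
    gcongr
    linarith
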